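/- **Theorem 4.2.** Let $N\ge 1$ be an integer, let $\theta>0$ be real, and let $\mathbb C_N=\mathbb C[x_1,\dots,x_N]$, on which the symmetric group $S_N$ acts by permuting the variables. For $1\le i\le N$ let $$D_i=\frac{\partial}{\partial x_i}+\theta\sum_{j\ne i}\frac{1-(i,j)}{x_i-x_j}$$ be the Dunkl operator, where $(i,j)$ interchanges $x_i$ and $x_j$, and for $m\ge 1$ let $P_m=\sum_{i=1}^N (x_iD_i)^m$, where $x_i$ denotes multiplication by $x_i$. For an exponent sequence $\gamma=(\gamma_1,\dots,\gamma_N)\in\mathbb Z_{\ge 0}^N$ let $\gamma^+$ be its nonincreasing rearrangement. For partitions $\lambda=(\lambda_1\ge\dots\ge\lambda_N\ge 0)$ and $\mu=(\mu_1\ge\dots\ge\mu_N\ge 0)$ write $|\lambda|=\sum_i\lambda_i$, and $\mu\preceq\lambda$ if $|\mu|=|\lambda|$ and $\mu_1+\dots+\mu_k\le\lambda_1+\dots+\lambda_k$ for all $1\le k\le N$. Let $V_\lambda\subset\mathbb C_N$ be the span of the monomials $x^\gamma$ with $\gamma^+=\lambda$; it is a representation of $S_N$. For an irreducible complex representation $\tau$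 of $S_N$, considered up to isomorphism (these isomorphism classes are parametrized by the partitions $\tau\vdash N$), let $V_{\lambda;\tau}$ be the $\tau$-isotypic component of $V_\lambda$. Then one can choose, for each triplet $(\lambda,\tau,i)$ with $\lambda=(\lambda_1\ge\dots\ge\lambda_N\ge 0)$, $\tau$ an isomorphism class of irreducible representations of $S_N$, and $1\le i\le\dim V_{\lambda;\tau}$, a nonzero polynomial $F_{\lambda,\tau,i}\in\mathbb C_N$ which is an eigenfunction of all the operators $P_m$, $m\ge 1$, such that: 1. $F_{\lambda,\tau,i}$ is homogeneous of degree $|\lambda|$. 2. All monomials $x^\gamma$ with nonzero coefficient in $F_{\lambda,\tau,i}$ satisfy $\gamma^+\preceq\lambda$. 3. The part of $F_{\lambda,\tau,i}$ spanned by the monomials in $V_\lambda$ belongs to $V_{\lambda;\tau}$. The functions $F_{\lambda,\tau,i}$ form a linear basis of $\mathbb C_N$. There are no other polynomial eigenfunctions, up to taking linear combinations within an eigenspace: if a nonzero $G\in\mathbb C_N$ satisfies $P_mG=c_mG$ for all $m\ge 1$, then $G$ is a linear combination of those $F_{\lambda,\tau,i}$ that satisfy $P_mF_{\lambda,\tau,i}=c_mF_{\lambda,\tau,i}$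 for all $m\ge1$; and for each single $m\ge 1$, if $P_mG=cG$, then $G$ is a linear combination of those $F_{\lambda,\tau,i}$ with $P_mF_{\lambda,\tau,i}=cF_{\lambda,\tau,i}$. -/

import Mathlib

open scoped MonoidAlgebra

noncomputable section

namespace HeckmanPolychronakos

open MvPolynomial

/-- The ring `ℂ[x_1, …, x_N]`. -/
abbrev Poly (N : ℕ) : Type := MvPolynomial (Fin N) ℂ

/-! ### The symmetric group permuting the variables -/

/-- The representation of the symmetric group on polynomials which permutes the variables,
`σ x_i = x_{σ i}`. -/
def permRep (N : ℕ) : Representation ℂ (Equiv.Perm (Fin N)) (Poly N) where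
  toFun σ := (rename σ : Poly N →ₐ[ℂ] Poly N).toLinearMap
  map_one' := by
    refine LinearMap.ext fun f => ?_
    simp [Equiv.Perm.coe_one]
  map_mul' σ τ := by
    refine LinearMap.ext fun f => ?_
    simp [rename_rename, Equiv.Perm.coe_mul]

theorem permRep_apply {N : ℕ} (σ : Equiv.Perm (Fin N)) (f : Poly N) :
    permRep N σ f = rename σ f := rfl

/-! ### Dunkl and Heckman–Polychronakos operators -/

theorem X_sub_X_dvd {N : ℕ} (i j : Fin N) (f : Poly N) :
    (X i - X j : Poly N) ∣ f - permRep N (Equiv.swap i j) f := by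
  rw [← Ideal.mem_span_singleton, ← Ideal.Quotient.eq]
  have h : (Ideal.Quotient.mkₐ ℂ (Ideal.span {(X i - X j : Poly N)})) =
      (Ideal.Quotient.mkₐ ℂ (Ideal.span {(X i - X j : Poly N)})).comp
        (rename (Equiv.swap i j)) := by
    have hij : Ideal.Quotient.mk (Ideal.span {(X i - X j : Poly N)}) (X i) =
        Ideal.Quotient.mk (Ideal.span {(X i - X j : Poly N)}) (X j) := by
      rw [Ideal.Quotient.eq]
      exact Ideal.mem_span_singleton_self _
    ext k
    simp only [Ideal.Quotient.mkₐ_eq_mk, AlgHom.comp_apply, rename_X]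
    rcases eq_or_ne k i with rfl | hki
    · simpa using hij
    · rcases eq_or_ne k j with rfl | hkj
      · simpa using hij.symm
      · rw [Equiv.swap_apply_of_ne_of_ne hki hkj]
  exact DFunLike.congr_fun h f

theorem X_sub_X_ne_zero {N : ℕ} {i j : Fin N} (h : i ≠ j) : (X i - X j : Poly N) ≠ 0 :=
  sub_ne_zero.2 fun h' => h (X_injective h')

/-- The operator `(1 - (i,j)) / (x_i - x_j)` on polynomials, for `i ≠ j`: its value at `f` is the
unique polynomial `q` with `f - (i,j) f = (x_i - x_j) q`. -/
def divDiff {N : ℕ} {i j : Fin N} (h : i ≠ j) : Poly N →ₗ[ℂ] Poly N where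
  toFun f := (X_sub_X_dvd i j f).choose
  map_add' f g := by
    apply mul_left_cancel₀ (X_sub_X_ne_zero h)
    rw [mul_add, ← (X_sub_X_dvd i j (f + g)).choose_spec, ← (X_sub_X_dvd i j f).choose_spec,
      ← (X_sub_X_dvd i j g).choose_spec, map_add]
    ring
  map_smul' c f := by
    apply mul_left_cancel₀ (X_sub_X_ne_zero h)
    rw [RingHom.id_apply, mul_smul_comm, ← (X_sub_X_dvd i j (c • f)).choose_spec,
      ← (X_sub_X_dvd i j f).choose_spec, map_smul, smul_sub]

theorem divDiff_spec {N : ℕ} {i j : Fin N} (h : i ≠ j) (f : Poly N) :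
    f - permRep N (Equiv.swap i j) f = (X i - X j) * divDiff h f :=
  (X_sub_X_dvd i j f).choose_spec

/-- The Dunkl operator `D_i = ∂/∂x_i + θ ∑_{j ≠ i} (1 - (i,j)) / (x_i - x_j)`. -/
def dunkl {N : ℕ} (θ : ℝ) (i : Fin N) : Poly N →ₗ[ℂ] Poly N :=
  (pderiv i).toLinearMap + (θ : ℂ) • ∑ j : {j : Fin N // i ≠ j}, divDiff j.2

/-- The operator `x_i D_i`. -/
def xDunkl {N : ℕ} (θ : ℝ) (i : Fin N) : Module.End ℂ (Poly N) :=
  LinearMap.mulLeft ℂ (X i) ∘ₗ dunkl θ i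

/-- The Heckman–Polychronakos operator `P_m = ∑_i (x_i D_i)^m`. -/
def hpOp (N : ℕ) (θ : ℝ) (m : ℕ) : Module.End ℂ (Poly N) :=
  ∑ i : Fin N, xDunkl θ i ^ m

/-! ### Partitions with at most `N` parts and the dominance order -/

/-- Partitions `λ_1 ≥ … ≥ λ_N ≥ 0` of length at most `N`. -/
abbrev PartLE (N : ℕ) : Type := {l : Fin N → ℕ // Antitone l}

/-- `|λ| = λ_1 + … + λ_N`. -/
def PartLE.size {N : ℕ} (l : PartLE N) : ℕ := ∑ i, l.1 i

/-- The (reflexive) dominance order `μ ⪯ λ`. -/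
def DomLE {N : ℕ} (μ l : PartLE N) : Prop :=
  μ.size = l.size ∧ ∀ k : Fin N, ∑ i ∈ Finset.Iic k, μ.1 i ≤ ∑ i ∈ Finset.Iic k, l.1 i

/-- `γ^+`: the nonincreasing rearrangement of the exponent sequence `γ`. -/
def sortDesc {N : ℕ} (γ : Fin N →₀ ℕ) : PartLE N :=
  ⟨γ ∘ Tuple.sort (OrderDual.toDual ∘ γ), Tuple.monotone_sort (OrderDual.toDual ∘ γ)⟩

theorem sortDesc_mapDomain {N : ℕ} (σ : Equiv.Perm (Fin N)) (γ : Fin N →₀ ℕ) :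
    sortDesc (γ.mapDomain σ) = sortDesc γ := by
  have h : (γ.mapDomain σ : Fin N → ℕ) = γ ∘ σ.symm := by
    ext a
    simp [Finsupp.mapDomain_equiv_apply]
  apply Subtype.ext
  have := Tuple.comp_perm_comp_sort_eq_comp_sort (f := OrderDual.toDual ∘ γ) (σ := σ.symm)
  simp only [sortDesc, h]
  exact this

/-- `V_λ`, the span of the monomials `x^γ` with `γ^+ = λ`. -/
def V {N : ℕ} (l : PartLE N) : Submodule ℂ (Poly N) :=
  Submodule.span ℂ {f | ∃ γ : Fin N →₀ ℕ, sortDesc γ = l ∧ f = monomial γ 1}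

/-- `V_λ` as a subrepresentation of the polynomial representation of the symmetric group. -/
def VRep {N : ℕ} (l : PartLE N) : Subrepresentation (permRep N) where
  toSubmodule := V l
  apply_mem_toSubmodule σ f hf := by
    refine (Submodule.span_le.2 ?_ : V l ≤ (V l).comap (permRep N σ)) hf
    rintro _ ⟨γ, hγ, rfl⟩
    refine Submodule.subset_span ⟨γ.mapDomain σ, ?_, ?_⟩
    · rw [sortDesc_mapDomain, hγ]
    · rw [permRep_apply, rename_monomial]

/-- The part of the polynomial `f` spanned by monomials in `V_λ`. -/
def partIn {N : ℕ} (l : PartLE N) (f : Poly N) : Poly N :=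
  ∑ γ ∈ f.support with sortDesc γ = l, monomial γ (f.coeff γ)

/-! ### Irreducible representations of the symmetric group and isotypic components -/

/-- An irreducible complex representation of the symmetric group `S_N`. -/
structure Irrep (N : ℕ) : Type 1 where
  carrier : Type
  [addCommGroup : AddCommGroup carrier]
  [module : Module ℂ carrier]
  rep : Representation ℂ (Equiv.Perm (Fin N)) carrier
  irreducible : rep.IsIrreducible

attribute [instance] Irrep.addCommGroup Irrep.module

/-- Isomorphism of irreducible representations. -/
instance Irrep.setoid (N : ℕ) : Setoid (Irrep N) where
  r S T := Nonempty (S.rep.Equiv T.rep)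
  iseqv :=
    { refl := fun S => ⟨Representation.Equiv.refl S.rep⟩
      symm := fun ⟨e⟩ => ⟨e.symm⟩
      trans := fun ⟨e⟩ ⟨f⟩ => ⟨e.trans f⟩ }

/-- Isomorphism classes of irreducible complex representations of `S_N`. -/
def IrrepClass (N : ℕ) : Type 1 := Quotient (Irrep.setoid N)

/-- `V_{λ;τ}`, the isotypic component of `τ` in `V_λ`: the sum of all subrepresentations of `V_λ`
that are isomorphic to a representation in the class `τ`. -/
def isotypic {N : ℕ} (l : PartLE N) (τ : IrrepClass N) : Submodule ℂ (Poly N) :=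
  (Subrepresentation.ofSubmodule'
    (isotypicComponent ℂ[Equiv.Perm (Fin N)] (VRep l).toRepresentation.asModule
      (Quotient.out τ).rep.asModule)).toSubmodule.map (V l).subtype

/-- The triplets `(λ, τ, i)` with `1 ≤ i ≤ dim V_{λ;τ}`. -/
structure Label (N : ℕ) : Type 1 where
  part : PartLE N
  irr : IrrepClass N
  idx : Fin (Module.finrank ℂ (isotypic part irr))

end HeckmanPolychronakos

end

open scoped MonoidAlgebra

noncomputable section

namespace HeckmanPolychronakos

open MvPolynomial

variable {N : ℕ}

/-! ### Commutation relations of Dunkl operators -/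

/-! The operators `P_m` are commuting, self-adjoint and triangular, so they can be diagonalised
jointly on finite-dimensional pieces.

Commutativity: the commutators of `D_i` with `x_j` involve only transpositions, which gives
`dunkl_comm`. The operators `x_i D_i` themselves do not commute, but the commutator of `(x_i D_i)^p`
with `(x_j D_j)^k` is symmetric in `p` and `k` (`pow_commutator_symm`). Summing over `i` and `j`
shows that the commutator of two power sums equals its own negative (`hpOp_commute`).

Self-adjointness: for the form `(f, g) ↦ (conj f)(D) g (0)` multiplication by `x_i` is adjoint to
`D_i`, so every `x_i D_i`, and hence every `P_m`, is self-adjoint. For `θ > 0` the form is positive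
definite (`re_dunklForm_self_pos`); the proof writes a polynomial of positive degree as `∑ x_i D_i
g` and inducts on the degree.

Triangularity: `x_i D_i` sends `x^γ` to monomials with exponents dominated by `γ^+`
(`xDunkl_monomial_mem`). So all `P_m` preserve the span `L` of the monomials with `γ^+ ⪯ λ` and the
span `K` of those with `γ^+ ≺ λ`, hence also the orthogonal complement of `K` in `L`. Taking the
leading part identifies this complement with `V_λ`. The operators induced on `V_λ` commute with
`S_N`, so the preimage of `V_{λ;τ}` is invariant, and the spectral theorem provides a joint
eigenbasis there (`exists_joint_eigenbasis_lift`).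

Basis: over all `(λ, τ)` the leading parts form a basis of the polynomial ring, by grouping
monomials and by semisimplicity, and the eigenfunctions differ from them by a unitriangular change
(`linearIndependent_of_triangular`, `mem_span_of_triangular`). In a basis of eigenvectors any
eigenvector has nonzero coordinates only at equal eigenvalues (`mem_span_of_eigenvector`). -/

theorem permRep_X_mul (σ : Equiv.Perm (Fin N)) (i : Fin N) (f : Poly N) :
    permRep N σ (X i * f) = X (σ i) * permRep N σ f := by
  simp [permRep_apply]

theorem permRep_mul_apply (σ τ : Equiv.Perm (Fin N)) (f : Poly N) :
    permRep N (σ * τ) f = permRep N σ (permRep N τ f) := by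
  rw [map_mul, Module.End.mul_apply]

theorem permRep_swap_self (i j : Fin N) (f : Poly N) :
    permRep N (Equiv.swap i j) (permRep N (Equiv.swap i j) f) = f := by
  rw [← permRep_mul_apply, Equiv.swap_mul_self, map_one, Module.End.one_apply]

theorem permRep_permRep_swap (σ : Equiv.Perm (Fin N)) (i j : Fin N) (f : Poly N) :
    permRep N σ (permRep N (Equiv.swap i j) f) =
      permRep N (Equiv.swap (σ i) (σ j)) (permRep N σ f) := by
  rw [← permRep_mul_apply, ← permRep_mul_apply, Equiv.mul_swap_eq_swap_mul]

theorem divDiff_eq_of_eq_mul {i j : Fin N} (h : i ≠ j) {f q : Poly N}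
    (hq : f - permRep N (Equiv.swap i j) f = (X i - X j) * q) : divDiff h f = q :=
  mul_left_cancel₀ (X_sub_X_ne_zero h) ((divDiff_spec h f).symm.trans hq)

theorem permRep_divDiff (σ : Equiv.Perm (Fin N)) {i j : Fin N} (h : i ≠ j) (f : Poly N) :
    permRep N σ (divDiff h f) = divDiff (σ.injective.ne h) (permRep N σ f) := by
  symm
  apply divDiff_eq_of_eq_mul
  rw [← permRep_permRep_swap, ← map_sub, divDiff_spec h, sub_mul, map_sub, permRep_X_mul,
    permRep_X_mul, sub_mul]

theorem dunkl_apply (θ : ℝ) (i : Fin N) (f : Poly N) :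
    dunkl θ i f = pderiv i f + (θ : ℂ) • ∑ j : {j : Fin N // i ≠ j}, divDiff j.2 f := by
  simp [dunkl]

theorem xDunkl_apply (θ : ℝ) (i : Fin N) (f : Poly N) :
    xDunkl θ i f = X i * dunkl θ i f := rfl

theorem permRep_dunkl (θ : ℝ) (σ : Equiv.Perm (Fin N)) (i : Fin N) (f : Poly N) :
    permRep N σ (dunkl θ i f) = dunkl θ (σ i) (permRep N σ f) := by
  rw [dunkl_apply, dunkl_apply, map_add, map_smul, map_sum]
  congr 1
  · rw [permRep_apply, permRep_apply, pderiv_rename σ.injective]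
  · simp_rw [permRep_divDiff]
    congr 1
    exact Fintype.sum_equiv (σ.subtypeEquiv fun a => (σ.injective.ne_iff).symm) _ _ fun _ => rfl

theorem permRep_xDunkl (θ : ℝ) (σ : Equiv.Perm (Fin N)) (i : Fin N) (f : Poly N) :
    permRep N σ (xDunkl θ i f) = xDunkl θ (σ i) (permRep N σ f) := by
  rw [xDunkl_apply, permRep_X_mul, permRep_dunkl, xDunkl_apply]

/-- The commutator `[D_i, x_j]`. -/
def dunklXComm (θ : ℝ) (i j : Fin N) : Poly N →ₗ[ℂ] Poly N :=
  if i = j then 1 + (θ : ℂ) • ∑ k : {k : Fin N // i ≠ k}, permRep N (Equiv.swap i k.1)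
  else -((θ : ℂ) • permRep N (Equiv.swap i j))

theorem dunklXComm_self (θ : ℝ) (i : Fin N) (f : Poly N) :
    dunklXComm θ i i f =
      f + (θ : ℂ) • ∑ k : {k : Fin N // i ≠ k}, permRep N (Equiv.swap i k.1) f := by
  simp [dunklXComm]

theorem dunklXComm_of_ne (θ : ℝ) {i j : Fin N} (h : i ≠ j) (f : Poly N) :
    dunklXComm θ i j f = -((θ : ℂ) • permRep N (Equiv.swap i j) f) := by
  simp [dunklXComm, h]

theorem dunklXComm_comm (θ : ℝ) (i j : Fin N) : dunklXComm θ i j = dunklXComm θ j i := by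
  rcases eq_or_ne i j with rfl | h
  · rfl
  · simp [dunklXComm, h, h.symm, Equiv.swap_comm]

theorem divDiff_X_mul_left {i j : Fin N} (h : i ≠ j) (f : Poly N) :
    divDiff h (X i * f) = X i * divDiff h f + permRep N (Equiv.swap i j) f := by
  apply divDiff_eq_of_eq_mul
  rw [permRep_X_mul, Equiv.swap_apply_left]
  linear_combination X i * divDiff_spec h f

theorem divDiff_X_mul_right {i j : Fin N} (h : i ≠ j) (f : Poly N) :
    divDiff h (X j * f) = X j * divDiff h f - permRep N (Equiv.swap i j) f := by
  apply divDiff_eq_of_eq_mul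
  rw [permRep_X_mul, Equiv.swap_apply_right]
  linear_combination X j * divDiff_spec h f

theorem divDiff_X_mul_of_ne {i j k : Fin N} (h : i ≠ j) (hi : k ≠ i) (hj : k ≠ j) (f : Poly N) :
    divDiff h (X k * f) = X k * divDiff h f := by
  apply divDiff_eq_of_eq_mul
  rw [permRep_X_mul, Equiv.swap_apply_of_ne_of_ne hi hj]
  linear_combination X k * divDiff_spec h f

/-- Each divided difference obeys a twisted Leibniz rule. For `i ≠ j` only the summand `k = j`
contributes a correction; for `i = j` every summand does. -/
theorem dunkl_X_mul (θ : ℝ) (i j : Fin N) (f : Poly N) :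
    dunkl θ i (X j * f) = X j * dunkl θ i f + dunklXComm θ i j f := by
  rw [dunkl_apply, dunkl_apply, Derivation.leibniz, pderiv_X]
  rcases eq_or_ne i j with rfl | h
  · simp_rw [divDiff_X_mul_left, dunklXComm_self, Finset.sum_add_distrib, ← Finset.mul_sum,
      Pi.single_eq_same, smul_add, mul_add, smul_eq_mul, mul_smul_comm]
    ring
  · have hs : ∑ k : {k : Fin N // i ≠ k}, divDiff k.2 (X j * f) =
        X j * ∑ k : {k : Fin N // i ≠ k}, divDiff k.2 f - permRep N (Equiv.swap i j) f := by
      rw [eq_sub_iff_add_eq', ← eq_sub_iff_add_eq, Finset.mul_sum,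
        ← Finset.sum_sub_distrib, Fintype.sum_eq_single ⟨j, h⟩, divDiff_X_mul_right]
      · ring
      · rintro ⟨k, hk⟩ hkj
        rw [divDiff_X_mul_of_ne hk h.symm (fun h' => hkj (Subtype.ext h'.symm)), sub_self]
    rw [hs, dunklXComm_of_ne θ h, Pi.single_eq_of_ne h.symm]
    simp only [smul_sub, mul_add, smul_eq_mul, mul_smul_comm, mul_zero]
    ring

theorem dunkl_C (θ : ℝ) (i : Fin N) (c : ℂ) : dunkl θ i (C c) = 0 := by
  have h : ∀ j : {j : Fin N // i ≠ j}, divDiff j.2 (C c : Poly N) = 0 := fun j =>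
    divDiff_eq_of_eq_mul _ (by simp [permRep_apply])
  simp [dunkl_apply, h]

/-- The transposition `(i, k)` commutes with `D_j` unless `k = j`, so one term of the sum survives,
and it is balanced by the commutator of `D_i` with `(i, j)`. -/
theorem dunklXComm_self_dunkl (θ : ℝ) {i j : Fin N} (hij : i ≠ j) (f : Poly N) :
    dunklXComm θ i i (dunkl θ j f) + dunkl θ i (dunklXComm θ j i f) =
      dunklXComm θ j i (dunkl θ i f) + dunkl θ j (dunklXComm θ i i f) := by
  have key : ∑ k : {k : Fin N // i ≠ k}, permRep N (Equiv.swap i k.1) (dunkl θ j f) -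
      ∑ k : {k : Fin N // i ≠ k}, dunkl θ j (permRep N (Equiv.swap i k.1) f) =
      permRep N (Equiv.swap i j) (dunkl θ j f) - permRep N (Equiv.swap i j) (dunkl θ i f) := by
    rw [← Finset.sum_sub_distrib, Fintype.sum_eq_single ⟨j, hij⟩]
    · simp [permRep_dunkl]
    · rintro ⟨k, hk⟩ hkj
      have hjk : j ≠ k := fun h' => hkj (Subtype.ext h'.symm)
      rw [permRep_dunkl, Equiv.swap_apply_of_ne_of_ne hij.symm hjk, sub_self]
  rw [dunklXComm_self, dunklXComm_self, dunklXComm_of_ne θ hij.symm, dunklXComm_of_ne θ hij.symm,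
    map_add, map_smul, map_sum, map_neg, map_smul, Equiv.swap_comm j i]
  have h1 : dunkl θ i (permRep N (Equiv.swap i j) f) =
      permRep N (Equiv.swap i j) (dunkl θ j f) := by
    rw [permRep_dunkl, Equiv.swap_apply_right]
  rw [h1]
  have := congrArg ((θ : ℂ) • ·) key
  simp only [smul_sub] at this
  linear_combination this

/-- By the Jacobi identity this says that `[D_i, D_j]` commutes with `x_k`, which is the induction
step for `dunkl_comm`. -/
theorem dunkl_dunklXComm (θ : ℝ) (i j k : Fin N) (f : Poly N) :
    dunklXComm θ i k (dunkl θ j f) + dunkl θ i (dunklXComm θ j k f) =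
      dunklXComm θ j k (dunkl θ i f) + dunkl θ j (dunklXComm θ i k f) := by
  rcases eq_or_ne i j with rfl | hij
  · rfl
  rcases eq_or_ne k i with rfl | hki
  · exact dunklXComm_self_dunkl θ hij f
  rcases eq_or_ne k j with rfl | hkj
  · exact (dunklXComm_self_dunkl θ hij.symm f).symm
  · rw [dunklXComm_of_ne θ hki.symm, dunklXComm_of_ne θ hki.symm, dunklXComm_of_ne θ hkj.symm,
      dunklXComm_of_ne θ hkj.symm, map_neg, map_neg, map_smul, map_smul, permRep_dunkl,
      permRep_dunkl, Equiv.swap_apply_of_ne_of_ne hij.symm hkj.symm,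
      Equiv.swap_apply_of_ne_of_ne hij hki.symm]
    ring

/-- Dunkl operators commute. -/
theorem dunkl_comm (θ : ℝ) (i j : Fin N) (f : Poly N) :
    dunkl θ i (dunkl θ j f) = dunkl θ j (dunkl θ i f) := by
  induction f using MvPolynomial.induction_on with
  | C a => simp [dunkl_C]
  | add p q hp hq => simp [hp, hq]
  | mul_X p k hp =>
    rw [mul_comm, dunkl_X_mul, dunkl_X_mul, map_add, map_add, dunkl_X_mul, dunkl_X_mul, hp]
    linear_combination dunkl_dunklXComm θ i j k p

/-! ### The Heckman–Polychronakos operators commute -/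

theorem permRep_swap_mul_xDunkl (θ : ℝ) (i j : Fin N) :
    permRep N (Equiv.swap i j) * xDunkl θ i = xDunkl θ j * permRep N (Equiv.swap i j) := by
  refine LinearMap.ext fun f => ?_
  simp only [Module.End.mul_apply]
  rw [permRep_xDunkl, Equiv.swap_apply_left]

/-- As `D_i` and `D_j` commute, only the terms with `[D_i, x_j]` and `[D_j, x_i]` remain; moving the
transposition to the right past the Dunkl operator gives this form. -/
theorem xDunkl_mul_sub (θ : ℝ) {i j : Fin N} (h : i ≠ j) :
    xDunkl θ i * xDunkl θ j - xDunkl θ j * xDunkl θ i =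
      (xDunkl θ j - xDunkl θ i) * ((θ : ℂ) • permRep N (Equiv.swap i j)) := by
  refine LinearMap.ext fun f => ?_
  simp only [Module.End.mul_apply, LinearMap.sub_apply, LinearMap.smul_apply, map_smul]
  simp only [xDunkl_apply, dunkl_X_mul, dunklXComm_of_ne θ h, dunklXComm_of_ne θ h.symm,
    permRep_dunkl, Equiv.swap_apply_left, Equiv.swap_apply_right, dunkl_comm θ i j,
    Equiv.swap_comm j i, mul_add, mul_neg, mul_smul_comm, smul_sub]
  ring

/-! ### Commutators of powers in an abstract ring -/

section Ring

variable {R : Type*} [Ring R] {a b s : R}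

/-- Expanding the commutator by the Leibniz rule and moving `s` to the right gives the telescoping
sum of `b ^ r * (b - a) * a ^ (k - 1 - r)`. -/
theorem mul_pow_sub_pow_mul (hab : a * b - b * a = (b - a) * s) (hb : s * b = a * s) (k : ℕ) :
    a * b ^ k - b ^ k * a = (b ^ k - a ^ k) * s := by
  induction k with
  | zero => simp
  | succ k ih =>
    calc a * b ^ (k + 1) - b ^ (k + 1) * a
        = (a * b ^ k - b ^ k * a) * b + b ^ k * (a * b - b * a) := by
          rw [pow_succ]; noncomm_ring
      _ = (b ^ k - a ^ k) * (s * b) + b ^ k * ((b - a) * s) := by rw [ih, hab, mul_assoc]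
      _ = (b ^ (k + 1) - a ^ (k + 1)) * s := by
          rw [hb, pow_succ, pow_succ]; noncomm_ring

/-- The point of this closed form is that its right-hand side is symmetric in `p` and `k`. -/
theorem pow_mul_pow_sub_pow_mul_pow (hab : a * b - b * a = (b - a) * s) (ha : s * a = b * s)
    (hb : s * b = a * s) (p k : ℕ) :
    a ^ p * b ^ k - b ^ k * a ^ p =
      ((∑ r ∈ Finset.range p, a ^ r * b ^ (p + k - 1 - r)) +
        (∑ r ∈ Finset.range k, a ^ r * b ^ (p + k - 1 - r)) -
        ∑ r ∈ Finset.range (p + k), a ^ r * b ^ (p + k - 1 - r)) * s := by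
  induction p with
  | zero => simp
  | succ p ih =>
    have hs : s * a ^ p = b ^ p * s := by
      have : SemiconjBy s a b := ha
      exact this.pow_right p
    have h1 : ∀ n, ∑ r ∈ Finset.range (n + 1), a ^ r * b ^ (p + 1 + k - 1 - r) =
        a * (∑ r ∈ Finset.range n, a ^ r * b ^ (p + k - 1 - r)) + b ^ (p + k) := by
      intro n
      rw [Finset.sum_range_succ', Finset.mul_sum]
      congr 1
      · refine Finset.sum_congr rfl fun r _ => ?_
        rw [pow_succ', mul_assoc, show p + 1 + k - 1 - (r + 1) = p + k - 1 - r by omega]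
      · rw [pow_zero, one_mul, show p + 1 + k - 1 - 0 = p + k by omega]
    -- The sum over `range (k + 1)` has one term too many; its last term `a ^ k * b ^ p` is split
    -- off.
    have h2 := h1 k
    rw [Finset.sum_range_succ, show p + 1 + k - 1 - k = p by omega, ← eq_sub_iff_add_eq] at h2
    rw [h1 p, h2, show p + 1 + k = (p + k) + 1 by omega,
      show p + k + 1 - 1 = p + 1 + k - 1 by omega,
      h1 (p + k)]
    calc a ^ (p + 1) * b ^ k - b ^ k * a ^ (p + 1)
        = a * (a ^ p * b ^ k - b ^ k * a ^ p) + (a * b ^ k - b ^ k * a) * a ^ p := by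
          rw [pow_succ']; noncomm_ring
      _ = _ := by
          rw [ih, mul_pow_sub_pow_mul hab hb, mul_assoc _ s, hs, add_comm p k, pow_add b k p]
          noncomm_ring

theorem pow_commutator_symm (hab : a * b - b * a = (b - a) * s) (ha : s * a = b * s)
    (hb : s * b = a * s) (p k : ℕ) :
    a ^ p * b ^ k - b ^ k * a ^ p = a ^ k * b ^ p - b ^ p * a ^ k := by
  rw [pow_mul_pow_sub_pow_mul_pow hab ha hb p k, pow_mul_pow_sub_pow_mul_pow hab ha hb k p,
    add_comm k p, add_comm (∑ r ∈ Finset.range k, _)]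

theorem commute_sum_sum [IsAddTorsionFree R] {ι : Type*} [Fintype ι] {x y : ι → R}
    (h : ∀ i j, x i * y j - y j * x i = y i * x j - x j * y i) :
    Commute (∑ i, x i) (∑ i, y i) := by
  have h1 : (∑ i, x i) * (∑ i, y i) - (∑ i, y i) * (∑ i, x i) =
      (∑ i, y i) * (∑ i, x i) - (∑ i, x i) * (∑ i, y i) := by
    have h2 : ∑ i, ∑ j, (x i * y j - y j * x i) = ∑ i, ∑ j, (y i * x j - x j * y i) :=
      Finset.sum_congr rfl fun i _ => Finset.sum_congr rfl fun j _ => h i j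
    simp only [Finset.sum_sub_distrib] at h2
    rw [Finset.sum_comm (f := fun i j => y j * x i),
      Finset.sum_comm (f := fun i j => x j * y i)] at h2
    simpa only [Finset.sum_mul_sum] using h2
  exact sub_eq_zero.1 (self_eq_neg.1 (by rwa [neg_sub]))

end Ring

theorem xDunkl_pow_commutator_symm (θ : ℝ) (i j : Fin N) (p k : ℕ) :
    xDunkl θ i ^ p * xDunkl θ j ^ k - xDunkl θ j ^ k * xDunkl θ i ^ p =
      xDunkl θ i ^ k * xDunkl θ j ^ p - xDunkl θ j ^ p * xDunkl θ i ^ k := by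
  rcases eq_or_ne i j with rfl | h
  · simp only [← pow_add, add_comm p k, sub_self]
  · refine pow_commutator_symm (xDunkl_mul_sub θ h) ?_ ?_ p k
    · rw [smul_mul_assoc, mul_smul_comm, permRep_swap_mul_xDunkl]
    · rw [smul_mul_assoc, mul_smul_comm, Equiv.swap_comm, permRep_swap_mul_xDunkl]

theorem hpOp_commute (N : ℕ) (θ : ℝ) (m n : ℕ) : Commute (hpOp N θ m) (hpOp N θ n) :=
  have : IsAddTorsionFree (Module.End ℂ (Poly N)) := IsAddTorsionFree.of_isTorsionFree ℂ _
  commute_sum_sum fun i j => xDunkl_pow_commutator_symm θ i j m n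

theorem permRep_hpOp (θ : ℝ) (m : ℕ) (σ : Equiv.Perm (Fin N)) (f : Poly N) :
    permRep N σ (hpOp N θ m f) = hpOp N θ m (permRep N σ f) := by
  have h : ∀ i, permRep N σ ((xDunkl θ i ^ m) f) = (xDunkl θ (σ i) ^ m) (permRep N σ f) := by
    intro i
    induction m with
    | zero => simp
    | succ m ih => rw [pow_succ', pow_succ', Module.End.mul_apply, Module.End.mul_apply,
        permRep_xDunkl, ih]
  simp only [hpOp, LinearMap.sum_apply, map_sum, h]
  exact Fintype.sum_equiv σ _ _ fun _ => rfl

/-! ### The Dunkl pairing -/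

open scoped IsMulCommutative in
/-- The substitution `f ↦ f(D_1, …, D_N)`. -/
def dunklHom (N : ℕ) (θ : ℝ) : Poly N →ₐ[ℂ] Module.End ℂ (Poly N) :=
  -- `aeval` needs a commutative target, so the substitution is made in the subalgebra generated by
  -- the Dunkl operators.
  have : IsMulCommutative (Algebra.adjoin ℂ (Set.range (dunkl (N := N) θ))) :=
    Algebra.isMulCommutative_adjoin ℂ (by
      rintro _ ⟨i, rfl⟩ _ ⟨j, rfl⟩
      exact LinearMap.ext (dunkl_comm θ i j))
  (Algebra.adjoin ℂ (Set.range (dunkl (N := N) θ))).val.comp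
    (aeval fun i => ⟨dunkl θ i, Algebra.subset_adjoin ⟨i, rfl⟩⟩)

theorem dunklHom_X (θ : ℝ) (i : Fin N) : dunklHom N θ (X i) = dunkl θ i := by
  simp [dunklHom]

/-- The Dunkl pairing `(f, g) ↦ (f(D) g)(0)`. -/
def dunklPairing (θ : ℝ) : Poly N →ₗ[ℂ] Poly N →ₗ[ℂ] ℂ where
  toFun f := (MvPolynomial.lcoeff ℂ 0).comp (dunklHom N θ f)
  map_add' f g := by rw [map_add, LinearMap.comp_add]
  map_smul' c f := by rw [map_smul, LinearMap.comp_smul, RingHom.id_apply]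

theorem dunklPairing_apply (θ : ℝ) (f g : Poly N) :
    dunklPairing θ f g = constantCoeff (dunklHom N θ f g) := rfl

theorem dunklPairing_C (θ : ℝ) (c : ℂ) (g : Poly N) :
    dunklPairing θ (C c) g = c * constantCoeff g := by
  rw [dunklPairing_apply, ← MvPolynomial.algebraMap_eq, AlgHom.commutes,
    Module.algebraMap_end_apply, smul_eq_C_mul, map_mul, constantCoeff_C]

theorem dunklPairing_X_mul (θ : ℝ) (i : Fin N) (f g : Poly N) :
    dunklPairing θ (X i * f) g = dunklPairing θ f (dunkl θ i g) := by
  rw [dunklPairing_apply, dunklPairing_apply, mul_comm, map_mul, dunklHom_X, Module.End.mul_apply]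

theorem dunklPairing_permRep (θ : ℝ) (σ : Equiv.Perm (Fin N)) (f g : Poly N) :
    dunklPairing θ (permRep N σ f) (permRep N σ g) = dunklPairing θ f g := by
  induction f using MvPolynomial.induction_on generalizing g with
  | C a => simp [permRep_apply, dunklPairing_C, constantCoeff_rename]
  | add p q hp hq => simp [hp, hq]
  | mul_X p k hp =>
    rw [mul_comm, permRep_X_mul, dunklPairing_X_mul, dunklPairing_X_mul, ← permRep_dunkl, hp]

theorem dunklPairing_permRep_swap (θ : ℝ) (i j : Fin N) (f g : Poly N) :
    dunklPairing θ (permRep N (Equiv.swap i j) f) g =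
      dunklPairing θ f (permRep N (Equiv.swap i j) g) := by
  rw [← dunklPairing_permRep θ (Equiv.swap i j), permRep_swap_self]

theorem dunklPairing_dunklXComm (θ : ℝ) (i j : Fin N) (f g : Poly N) :
    dunklPairing θ (dunklXComm θ i j f) g = dunklPairing θ f (dunklXComm θ i j g) := by
  rcases eq_or_ne i j with rfl | h
  · simp [dunklXComm_self, dunklPairing_permRep_swap]
  · simp [dunklXComm_of_ne θ h, dunklPairing_permRep_swap]

/-- Moving a factor `x_k` of `f` across creates the commutator of `D_k` with `x_i`, which is
self-adjoint and symmetric in the two indices. This is what makes the pairing symmetric. -/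
theorem dunklPairing_mul_X_right (θ : ℝ) (i : Fin N) (f g : Poly N) :
    dunklPairing θ f (X i * g) = dunklPairing θ (dunkl θ i f) g := by
  induction f using MvPolynomial.induction_on generalizing i g with
  | C a => simp [dunklPairing_C, dunkl_C]
  | add p q hp hq => simp [hp, hq]
  | mul_X p k hp =>
    rw [mul_comm, dunklPairing_X_mul, dunkl_X_mul, dunkl_X_mul, map_add, map_add,
      LinearMap.add_apply, dunklPairing_X_mul, dunklPairing_dunklXComm, hp, dunklXComm_comm]

theorem dunklPairing_comm (θ : ℝ) (f g : Poly N) :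
    dunklPairing θ f g = dunklPairing θ g f := by
  induction f using MvPolynomial.induction_on generalizing g with
  | C a =>
    induction g using MvPolynomial.induction_on with
    | C b => simp [dunklPairing_C, mul_comm]
    | add p q hp hq => simp [hp, hq]
    | mul_X p k _ => rw [mul_comm, dunklPairing_X_mul, dunkl_C, dunklPairing_C]; simp
  | add p q hp hq => simp [hp, hq]
  | mul_X p k hp => rw [mul_comm, dunklPairing_X_mul, hp, dunklPairing_mul_X_right]

/-! ### The Hermitian form -/

/-- Complex conjugation of the coefficients. -/
abbrev conjPoly : Poly N →+* Poly N := MvPolynomial.map (starRingEnd ℂ)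

theorem conjPoly_conjPoly (f : Poly N) : conjPoly (conjPoly f) = f := by
  ext γ
  simp [coeff_map]

theorem conjPoly_smul (c : ℂ) (f : Poly N) : conjPoly (c • f) = starRingEnd ℂ c • conjPoly f := by
  simp [smul_eq_C_mul]

theorem conjPoly_permRep (σ : Equiv.Perm (Fin N)) (f : Poly N) :
    conjPoly (permRep N σ f) = permRep N σ (conjPoly f) := by
  rw [permRep_apply, permRep_apply, map_rename]

theorem conjPoly_divDiff {i j : Fin N} (h : i ≠ j) (f : Poly N) :
    conjPoly (divDiff h f) = divDiff h (conjPoly f) := by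
  symm
  apply divDiff_eq_of_eq_mul
  rw [← conjPoly_permRep, ← map_sub, divDiff_spec h, map_mul, map_sub, map_X, map_X]

theorem conjPoly_dunkl (θ : ℝ) (i : Fin N) (f : Poly N) :
    conjPoly (dunkl θ i f) = dunkl θ i (conjPoly f) := by
  rw [dunkl_apply, dunkl_apply, map_add, conjPoly_smul, map_sum, pderiv_map, Complex.conj_ofReal]
  simp_rw [conjPoly_divDiff]

theorem dunklPairing_conjPoly (θ : ℝ) (f g : Poly N) :
    dunklPairing θ (conjPoly f) (conjPoly g) = starRingEnd ℂ (dunklPairing θ f g) := by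
  induction f using MvPolynomial.induction_on generalizing g with
  | C a => simp [dunklPairing_C, constantCoeff_map]
  | add p q hp hq => simp [hp, hq]
  | mul_X p k hp =>
    rw [mul_comm, map_mul, map_X, dunklPairing_X_mul, dunklPairing_X_mul, ← conjPoly_dunkl, hp]

/-- The Hermitian form `(f, g) ↦ (conj f)(D) g (0)`. -/
def dunklForm (θ : ℝ) (f g : Poly N) : ℂ := dunklPairing θ (conjPoly f) g

theorem dunklForm_add_left (θ : ℝ) (f g h : Poly N) :
    dunklForm θ (f + g) h = dunklForm θ f h + dunklForm θ g h := by
  simp [dunklForm]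

theorem dunklForm_add_right (θ : ℝ) (f g h : Poly N) :
    dunklForm θ f (g + h) = dunklForm θ f g + dunklForm θ f h := by
  simp [dunklForm]

theorem dunklForm_sub_left (θ : ℝ) (f g h : Poly N) :
    dunklForm θ (f - g) h = dunklForm θ f h - dunklForm θ g h := by
  simp [dunklForm]

theorem dunklForm_sub_right (θ : ℝ) (f g h : Poly N) :
    dunklForm θ f (g - h) = dunklForm θ f g - dunklForm θ f h := by
  simp [dunklForm]

theorem dunklForm_smul_left (θ : ℝ) (c : ℂ) (f g : Poly N) :
    dunklForm θ (c • f) g = starRingEnd ℂ c * dunklForm θ f g := by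
  simp [dunklForm, conjPoly_smul]

theorem dunklForm_smul_right (θ : ℝ) (c : ℂ) (f g : Poly N) :
    dunklForm θ f (c • g) = c * dunklForm θ f g := by
  simp [dunklForm]

theorem dunklForm_sum_left (θ : ℝ) {ι : Type*} (s : Finset ι) (f : ι → Poly N) (g : Poly N) :
    dunklForm θ (∑ i ∈ s, f i) g = ∑ i ∈ s, dunklForm θ (f i) g := by
  simp [dunklForm]

theorem dunklForm_sum_right (θ : ℝ) {ι : Type*} (s : Finset ι) (f : Poly N) (g : ι → Poly N) :
    dunklForm θ f (∑ i ∈ s, g i) = ∑ i ∈ s, dunklForm θ f (g i) := by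
  simp [dunklForm]

theorem dunklForm_conj_symm (θ : ℝ) (f g : Poly N) :
    starRingEnd ℂ (dunklForm θ g f) = dunklForm θ f g := by
  rw [dunklForm, dunklForm, ← dunklPairing_conjPoly, conjPoly_conjPoly, dunklPairing_comm]

theorem dunklForm_X_mul_left (θ : ℝ) (i : Fin N) (f g : Poly N) :
    dunklForm θ (X i * f) g = dunklForm θ f (dunkl θ i g) := by
  rw [dunklForm, map_mul, map_X, dunklPairing_X_mul, dunklForm]

theorem dunklForm_X_mul_right (θ : ℝ) (i : Fin N) (f g : Poly N) :
    dunklForm θ f (X i * g) = dunklForm θ (dunkl θ i f) g := by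
  rw [dunklForm, dunklPairing_mul_X_right, dunklForm, conjPoly_dunkl]

theorem dunklForm_xDunkl (θ : ℝ) (i : Fin N) (f g : Poly N) :
    dunklForm θ (xDunkl θ i f) g = dunklForm θ f (xDunkl θ i g) := by
  rw [xDunkl_apply, xDunkl_apply, dunklForm_X_mul_left, dunklForm_X_mul_right]

theorem dunklForm_permRep (θ : ℝ) (σ : Equiv.Perm (Fin N)) (f g : Poly N) :
    dunklForm θ (permRep N σ f) (permRep N σ g) = dunklForm θ f g := by
  rw [dunklForm, conjPoly_permRep, dunklPairing_permRep, dunklForm]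

theorem dunklForm_hpOp (θ : ℝ) (m : ℕ) (f g : Poly N) :
    dunklForm θ (hpOp N θ m f) g = dunklForm θ f (hpOp N θ m g) := by
  have h : ∀ i f g, dunklForm θ ((xDunkl θ i ^ m) f) g =
      dunklForm θ f ((xDunkl (N := N) θ i ^ m) g) := by
    intro i
    induction m with
    | zero => simp
    | succ m ih =>
      intro f g
      rw [pow_succ, Module.End.mul_apply, ih, dunklForm_xDunkl, ← Module.End.mul_apply,
        ← pow_succ', ← pow_succ]
  simp only [hpOp, LinearMap.sum_apply, dunklForm_sum_left, dunklForm_sum_right, h]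

/-! ### Homogeneity -/

/-- A monomial of positive degree is a variable times a monomial of degree one less, so facts about
Dunkl operators follow from their commutation with variables. -/
theorem isHomogeneous_induction {P : ℕ → Poly N → Prop} (hzero : ∀ n, P n 0)
    (hC : ∀ c, P 0 (C c)) (hadd : ∀ n f g, P n f → P n g → P n (f + g))
    (hX : ∀ n i f, f.IsHomogeneous n → P n f → P (n + 1) (X i * f))
    {n : ℕ} {f : Poly N} (hf : f.IsHomogeneous n) : P n f := by
  have mono : ∀ (n : ℕ) (γ : Fin N →₀ ℕ) (c : ℂ), γ.degree = n → P n (monomial γ c) := by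
    intro n
    induction n with
    | zero =>
      intro γ c h
      rw [Finsupp.degree_eq_zero_iff] at h
      subst h
      exact hC c
    | succ n ih =>
      intro γ c h
      obtain ⟨i, hi⟩ : ∃ i, γ i ≠ 0 := by
        by_contra! h0
        rw [show γ = 0 from Finsupp.ext h0, map_zero] at h
        omega
      have hγ : Finsupp.single i 1 + (γ - Finsupp.single i 1) = γ := by
        rw [add_comm]
        refine tsub_add_cancel_of_le ?_
        rw [Finsupp.single_le_iff]
        omega
      have hd : (γ - Finsupp.single i 1).degree = n := by
        rw [← hγ, map_add, Finsupp.degree_single] at h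
        omega
      have := hX n i _ (isHomogeneous_monomial c hd) (ih _ c hd)
      rwa [X, monomial_mul, one_mul, hγ] at this
  rw [f.as_sum]
  have : ∀ s ⊆ f.support, P n (∑ v ∈ s, monomial v (coeff v f)) := by
    intro s
    induction s using Finset.induction_on with
    | empty => intro _; simpa using hzero n
    | insert a s ha ih =>
      intro hs
      rw [Finset.sum_insert ha]
      refine hadd _ _ _ (mono _ _ _ ?_) (ih fun x hx => hs (Finset.mem_insert_of_mem hx))
      have := hf (mem_support_iff.1 (hs (Finset.mem_insert_self a s)))
      rw [Finsupp.degree_eq_weight_one]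
      exact this
  exact this _ subset_rfl

theorem isHomogeneous_permRep (σ : Equiv.Perm (Fin N)) {n : ℕ} {f : Poly N}
    (hf : f.IsHomogeneous n) : (permRep N σ f).IsHomogeneous n :=
  hf.rename_isHomogeneous

theorem isHomogeneous_dunklXComm (θ : ℝ) (i j : Fin N) {n : ℕ} {f : Poly N}
    (hf : f.IsHomogeneous n) : (dunklXComm θ i j f).IsHomogeneous n := by
  rw [← mem_homogeneousSubmodule] at hf ⊢
  have h : ∀ σ, permRep N σ f ∈ homogeneousSubmodule (Fin N) ℂ n := fun σ =>
    isHomogeneous_permRep σ hf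
  rcases eq_or_ne i j with rfl | hij
  · rw [dunklXComm_self]
    exact add_mem hf (Submodule.smul_mem _ _ (sum_mem fun k _ => h _))
  · rw [dunklXComm_of_ne θ hij]
    exact neg_mem (Submodule.smul_mem _ _ (h _))

theorem dunkl_isHomogeneous (θ : ℝ) (i : Fin N) {n : ℕ} {f : Poly N} (hf : f.IsHomogeneous n) :
    (n = 0 → dunkl θ i f = 0) ∧ ∀ k, n = k + 1 → (dunkl θ i f).IsHomogeneous k := by
  refine isHomogeneous_induction (P := fun n f => (n = 0 → dunkl θ i f = 0) ∧
    ∀ k, n = k + 1 → (dunkl θ i f).IsHomogeneous k) ?_ ?_ ?_ ?_ hf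
  · intro n
    simp [isHomogeneous_zero]
  · intro c
    simp [dunkl_C]
  · rintro n f g ⟨hf, hf'⟩ ⟨hg, hg'⟩
    rw [map_add]
    exact ⟨fun h => by rw [hf h, hg h, add_zero], fun k h => (hf' k h).add (hg' k h)⟩
  · rintro n j f hn ⟨hf, hf'⟩
    refine ⟨fun h => absurd h (Nat.succ_ne_zero n), fun k h => ?_⟩
    obtain rfl : n = k := by omega
    rw [dunkl_X_mul]
    refine IsHomogeneous.add ?_ (isHomogeneous_dunklXComm θ i j hn)
    rcases n with _ | k
    · rw [hf rfl, mul_zero]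
      exact isHomogeneous_zero _ _ _
    · rw [add_comm k 1]
      exact (isHomogeneous_X _ j).mul (hf' k rfl)

theorem isHomogeneous_xDunkl (θ : ℝ) (i : Fin N) {n : ℕ} {f : Poly N} (hf : f.IsHomogeneous n) :
    (xDunkl θ i f).IsHomogeneous n := by
  rw [xDunkl_apply]
  rcases n with _ | k
  · rw [(dunkl_isHomogeneous θ i hf).1 rfl, mul_zero]
    exact isHomogeneous_zero _ _ _
  · rw [add_comm k 1]
    exact (isHomogeneous_X _ i).mul ((dunkl_isHomogeneous θ i hf).2 k rfl)

theorem dunklForm_eq_zero_of_ne (θ : ℝ) {n m : ℕ} (hnm : n ≠ m) {f g : Poly N}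
    (hf : f.IsHomogeneous n) (hg : g.IsHomogeneous m) : dunklForm θ f g = 0 := by
  have hf' : (conjPoly f).IsHomogeneous n := hf.map _
  rw [dunklForm]
  generalize conjPoly f = f at hf'
  refine isHomogeneous_induction (P := fun n f => ∀ m (g : Poly N), g.IsHomogeneous m → n ≠ m →
    dunklPairing θ f g = 0) ?_ ?_ ?_ ?_ hf' m g hg hnm
  · simp
  · intro c m g hg hm
    rw [dunklPairing_C, constantCoeff_eq, hg.coeff_eq_zero, mul_zero]
    simpa using hm
  · intro n f f' h h' m g hg hm
    rw [map_add, LinearMap.add_apply, h m g hg hm, h' m g hg hm, add_zero]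
  · intro n i f _ h m g hg hm
    rw [dunklPairing_X_mul]
    rcases m with _ | k
    · rw [(dunkl_isHomogeneous θ i hg).1 rfl, map_zero]
    · exact h k _ ((dunkl_isHomogeneous θ i hg).2 k rfl) (by omega)

/-! ### The Dunkl Euler operator -/

/-- The operator `∑_i x_i D_i`. -/
def dunklEuler (N : ℕ) (θ : ℝ) : Module.End ℂ (Poly N) := ∑ i, xDunkl θ i

theorem dunklEuler_apply (θ : ℝ) (f : Poly N) : dunklEuler N θ f = ∑ i, X i * dunkl θ i f := by
  simp [dunklEuler, xDunkl_apply]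

theorem X_mul_divDiff_add {i j : Fin N} (h : i ≠ j) (f : Poly N) :
    X i * divDiff h f + X j * divDiff h.symm f = f - permRep N (Equiv.swap i j) f := by
  have : divDiff h.symm f = -divDiff h f := by
    apply divDiff_eq_of_eq_mul
    rw [Equiv.swap_comm, divDiff_spec h]
    ring
  rw [this, divDiff_spec h]
  ring

/-- Euler's identity gives `n`, and the terms `(i, j)` and `(j, i)` combine to `1 - (i, j)`. The sum
over ordered pairs counts every transposition twice, whence `θ / 2`; diagonal terms vanish. -/
theorem dunklEuler_eq (θ : ℝ) {n : ℕ} {f : Poly N} (hf : f.IsHomogeneous n) :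
    dunklEuler N θ f = (n : ℂ) • f +
      ((θ / 2 : ℝ) : ℂ) • ∑ i, ∑ j, (f - permRep N (Equiv.swap i j) f) := by
  have h1 : ∀ i : Fin N, ∑ j : {j : Fin N // i ≠ j}, X i * divDiff j.2 f =
      ∑ j, if h : i ≠ j then X i * divDiff h f else 0 := by
    intro i
    rw [Finset.sum_dite, Finset.sum_const_zero, add_zero]
    refine Fintype.sum_equiv (Equiv.subtypeEquivRight (by simp)) _ _ fun _ => rfl
  have h2 : (∑ i, ∑ j, if h : i ≠ j then X i * divDiff h f else 0) +
      (∑ i, ∑ j, if h : i ≠ j then X i * divDiff h f else 0) =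
      ∑ i, ∑ j, (f - permRep N (Equiv.swap i j) f) := by
    nth_rewrite 2 [Finset.sum_comm]
    simp only [← Finset.sum_add_distrib]
    refine Finset.sum_congr rfl fun i _ => Finset.sum_congr rfl fun j _ => ?_
    rcases eq_or_ne i j with rfl | h
    · simp [← Equiv.Perm.one_def]
    · simp only [h, h.symm, ne_eq, not_false_eq_true, dite_true]
      exact X_mul_divDiff_add h f
  have h3 : ∑ i, X i * pderiv i f = (n : ℂ) • f := by
    rw [hf.sum_X_mul_pderiv, Nat.cast_smul_eq_nsmul]
  simp only [dunklEuler_apply, dunkl_apply, mul_add, Finset.sum_add_distrib, h3, mul_smul_comm,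
    Finset.mul_sum, h1, ← Finset.smul_sum, ← h2]
  rw [← two_smul ℂ, smul_smul]
  congr 2
  push_cast
  ring

theorem exists_norm_coeff_max (f : Poly N) :
    ∃ γ, ∀ δ, ‖coeff δ f‖ ≤ ‖coeff γ f‖ := by
  rcases f.support.eq_empty_or_nonempty with h | h
  · refine ⟨0, fun δ => ?_⟩
    rw [support_eq_empty.1 h]
    simp
  · obtain ⟨γ, _, hγ⟩ := f.support.exists_max_image (fun δ => ‖coeff δ f‖) h
    refine ⟨γ, fun δ => ?_⟩
    by_cases hδ : δ ∈ f.support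
    · exact hγ δ hδ
    · rw [notMem_support_iff.1 hδ, norm_zero]
      exact norm_nonneg _

/-- A maximum principle: permuting variables permutes coefficients, so at a coefficient `c` of
largest modulus the equation gives `(n + θ N² / 2) |c| ≤ (θ N² / 2) |c|`. -/
theorem eq_zero_of_dunklEuler_eq_zero {θ : ℝ} (hθ : 0 < θ) {n : ℕ} (hn : n ≠ 0) {f : Poly N}
    (hf : f.IsHomogeneous n) (h0 : dunklEuler N θ f = 0) : f = 0 := by
  obtain ⟨γ, hγ⟩ := exists_norm_coeff_max f
  have hs : ∀ σ, ‖coeff γ (permRep N σ f)‖ ≤ ‖coeff γ f‖ := by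
    intro σ
    have : γ = (γ.mapDomain σ.symm).mapDomain σ := by
      rw [← Finsupp.mapDomain_comp, Equiv.self_comp_symm, Finsupp.mapDomain_id]
    conv_lhs => rw [this, permRep_apply, coeff_rename_mapDomain _ σ.injective]
    exact hγ _
  have h1 : ((n : ℂ) + ((θ / 2 : ℝ) : ℂ) * (N * N)) * coeff γ f =
      ((θ / 2 : ℝ) : ℂ) * ∑ i, ∑ j, coeff γ (permRep N (Equiv.swap i j) f) := by
    rw [dunklEuler_eq θ hf] at h0
    have := congrArg (coeff γ) h0
    simp only [coeff_add, coeff_smul, coeff_sum, coeff_sub] at this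
    simp only [Finset.sum_sub_distrib, Finset.sum_const, Finset.card_univ, Fintype.card_fin,
      coeff_zero, nsmul_eq_mul, smul_eq_mul] at this
    linear_combination this
  have h2 := congrArg norm h1
  rw [norm_mul, norm_mul, Complex.norm_real, Real.norm_of_nonneg (by positivity),
    show ((n : ℂ) + ((θ / 2 : ℝ) : ℂ) * (N * N)) = ((n + θ / 2 * (N * N) : ℝ) : ℂ) by push_cast; rfl,
    Complex.norm_real, Real.norm_of_nonneg (by positivity)] at h2
  have h3 : ‖∑ i : Fin N, ∑ j : Fin N, coeff γ (permRep N (Equiv.swap i j) f)‖ ≤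
      N * N * ‖coeff γ f‖ := by
    calc _ ≤ ∑ i : Fin N, ∑ j : Fin N, ‖coeff γ f‖ :=
          norm_sum_le_of_le _ fun i _ => norm_sum_le_of_le _ fun j _ => hs _
      _ = N * N * ‖coeff γ f‖ := by simp [mul_assoc]
  have h4 : (n : ℝ) * ‖coeff γ f‖ ≤ 0 := by
    have := mul_le_mul_of_nonneg_left h3 (by positivity : (0 : ℝ) ≤ θ / 2)
    linarith
  have hn' : (0 : ℝ) < n := by positivity
  have h5 : ‖coeff γ f‖ ≤ 0 := nonpos_of_mul_nonpos_right h4 hn'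
  ext δ
  rw [coeff_zero, ← norm_le_zero_iff]
  exact (hγ δ).trans h5

theorem isHomogeneous_dunklEuler (θ : ℝ) {n : ℕ} {f : Poly N} (hf : f.IsHomogeneous n) :
    (dunklEuler N θ f).IsHomogeneous n := by
  rw [dunklEuler, LinearMap.sum_apply]
  exact IsHomogeneous.sum _ _ _ fun i _ => isHomogeneous_xDunkl θ i hf

theorem exists_dunklEuler_eq {θ : ℝ} (hθ : 0 < θ) {n : ℕ} (hn : n ≠ 0) {f : Poly N}
    (hf : f.IsHomogeneous n) : ∃ g : Poly N, g.IsHomogeneous n ∧ dunklEuler N θ g = f := by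
  have : FiniteDimensional ℂ (homogeneousSubmodule (Fin N) ℂ n) :=
    Module.Finite.iff_fg.2 (homogeneousSubmodule_fg _ _ n)
  let e := (dunklEuler N θ).restrict (p := homogeneousSubmodule (Fin N) ℂ n)
    (q := homogeneousSubmodule (Fin N) ℂ n) fun f hf => isHomogeneous_dunklEuler θ hf
  have he : Function.Injective e := by
    rw [← LinearMap.ker_eq_bot, LinearMap.ker_eq_bot']
    intro g hg
    exact Subtype.ext (eq_zero_of_dunklEuler_eq_zero hθ hn g.2 (congrArg Subtype.val hg))
  obtain ⟨g, hg⟩ := LinearMap.surjective_of_injective he ⟨f, hf⟩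
  exact ⟨g, g.2, congrArg Subtype.val hg⟩

/-! ### Positivity -/

theorem dunklForm_dunklEuler_left (θ : ℝ) (f g : Poly N) :
    dunklForm θ (dunklEuler N θ f) g = ∑ i, dunklForm θ (dunkl θ i f) (dunkl θ i g) := by
  simp only [dunklEuler_apply, dunklForm_sum_left, dunklForm_X_mul_left]

theorem permRep_dunklEuler (θ : ℝ) (σ : Equiv.Perm (Fin N)) (f : Poly N) :
    permRep N σ (dunklEuler N θ f) = dunklEuler N θ (permRep N σ f) := by
  simp only [dunklEuler, LinearMap.sum_apply, map_sum, permRep_xDunkl]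
  exact Fintype.sum_equiv σ _ _ fun _ => rfl

/-- Let `E` be the Dunkl Euler operator and write `f = E g`. Expanding only the second factor gives
`⟨E g, E g⟩ = n ⟨E g, g⟩ + (θ / 2) ∑ ⟨E g, g - s g⟩` over transpositions `s`, with `n` here the
degree of `f`. Since `⟨E g, h⟩ = ∑ ⟨D_i g, D_i h⟩`, lower degree controls the signs. -/
theorem re_dunklForm_self_pos_of_isHomogeneous {θ : ℝ} (hθ : 0 < θ) (n : ℕ) {f : Poly N}
    (hf : f.IsHomogeneous n) (h0 : f ≠ 0) : 0 < (dunklForm θ f f).re := by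
  induction n generalizing f with
  | zero =>
    obtain ⟨c, rfl⟩ : ∃ c, f = C c :=
      ⟨_, totalDegree_eq_zero_iff_eq_C.1 (hf.totalDegree h0)⟩
    have hc : c ≠ 0 := by rintro rfl; simp at h0
    rw [dunklForm, map_C, dunklPairing_C, constantCoeff_C, mul_comm, Complex.mul_conj,
      Complex.ofReal_re]
    exact Complex.normSq_pos.2 hc
  | succ n ih =>
    have nonneg : ∀ g : Poly N, g.IsHomogeneous n → 0 ≤ (dunklForm θ g g).re := by
      intro g hg
      rcases eq_or_ne g 0 with rfl | hg0
      · simp [dunklForm]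
      · exact (ih hg hg0).le
    have hD : ∀ i, ∀ g : Poly N, g.IsHomogeneous (n + 1) → (dunkl θ i g).IsHomogeneous n :=
      fun i g hg => (dunkl_isHomogeneous θ i hg).2 n rfl
    have nonneg' : ∀ g : Poly N, g.IsHomogeneous (n + 1) →
        0 ≤ (dunklForm θ (dunklEuler N θ g) g).re := by
      intro g hg
      rw [dunklForm_dunklEuler_left, Complex.re_sum]
      exact Finset.sum_nonneg fun i _ => nonneg _ (hD i g hg)
    -- The transposition `s` is isometric and commutes with `E`, so `2 ⟨E g, g - s g⟩ = ⟨E (g - s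
    -- g), g - s g⟩`.
    have swap_nonneg : ∀ (i j) (g : Poly N), g.IsHomogeneous (n + 1) →
        0 ≤ (dunklForm θ (dunklEuler N θ g) (g - permRep N (Equiv.swap i j) g)).re := by
      intro i j g hg
      have h := nonneg' (g - permRep N (Equiv.swap i j) g) (hg.sub (isHomogeneous_permRep _ hg))
      have h1 := dunklForm_permRep θ (Equiv.swap i j) (dunklEuler N θ g) g
      have h2 := dunklForm_permRep θ (Equiv.swap i j) (dunklEuler N θ g)
        (permRep N (Equiv.swap i j) g)
      rw [permRep_swap_self] at h2
      rw [map_sub, ← permRep_dunklEuler, dunklForm_sub_left, dunklForm_sub_right,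
        dunklForm_sub_right, h1, h2] at h
      rw [dunklForm_sub_right]
      simp only [Complex.sub_re] at h ⊢
      linarith
    obtain ⟨g, hg, rfl⟩ := exists_dunklEuler_eq hθ n.succ_ne_zero hf
    have hpos : 0 < (dunklForm θ (dunklEuler N θ g) g).re := by
      obtain ⟨i, hi⟩ : ∃ i, dunkl θ i g ≠ 0 := by
        by_contra! h
        exact h0 (by simp [dunklEuler_apply, h])
      rw [dunklForm_dunklEuler_left, Complex.re_sum]
      exact Finset.sum_pos' (fun i _ => nonneg _ (hD i g hg))
        ⟨i, Finset.mem_univ _, ih (hD i g hg) hi⟩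
    nth_rewrite 2 [dunklEuler_eq θ hg]
    rw [dunklForm_add_right, dunklForm_smul_right, dunklForm_smul_right]
    simp only [dunklForm_sum_right]
    rw [Complex.add_re, Complex.re_ofReal_mul, ← Complex.ofReal_natCast, Complex.re_ofReal_mul]
    refine add_pos_of_pos_of_nonneg (by positivity) (mul_nonneg (by positivity) ?_)
    simp only [Complex.re_sum]
    exact Finset.sum_nonneg fun i _ => Finset.sum_nonneg fun j _ => swap_nonneg i j g hg

theorem re_dunklForm_self_pos {θ : ℝ} (hθ : 0 < θ) {f : Poly N} (h0 : f ≠ 0) :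
    0 < (dunklForm θ f f).re := by
  have h : dunklForm θ f f = ∑ n ∈ Finset.range (f.totalDegree + 1),
      dunklForm θ (homogeneousComponent n f) (homogeneousComponent n f) := by
    conv_lhs => rw [← sum_homogeneousComponent f]
    rw [dunklForm_sum_left]
    refine Finset.sum_congr rfl fun n hn => ?_
    rw [dunklForm_sum_right]
    exact Finset.sum_eq_single_of_mem n hn fun m _ hm =>
      dunklForm_eq_zero_of_ne θ hm.symm (homogeneousComponent_isHomogeneous n f)
        (homogeneousComponent_isHomogeneous m f)
  have hpos : ∀ n, homogeneousComponent n f ≠ 0 →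
      0 < (dunklForm θ (homogeneousComponent n f) (homogeneousComponent n f)).re := fun n hn =>
    re_dunklForm_self_pos_of_isHomogeneous hθ n (homogeneousComponent_isHomogeneous n f) hn
  obtain ⟨n, hn, hn0⟩ : ∃ n ∈ Finset.range (f.totalDegree + 1), homogeneousComponent n f ≠ 0 := by
    by_contra! h'
    exact h0 (by rw [← sum_homogeneousComponent f, Finset.sum_eq_zero h'])
  rw [h, Complex.re_sum]
  refine Finset.sum_pos' (fun m _ => ?_) ⟨n, hn, hpos n hn0⟩
  rcases eq_or_ne (homogeneousComponent m f) 0 with h' | h'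
  · simp [h', dunklForm]
  · exact (hpos m h').le

/-- The Dunkl inner product on polynomials. -/
abbrev dunklCore (N : ℕ) {θ : ℝ} (hθ : 0 < θ) : InnerProductSpace.Core ℂ (Poly N) where
  inner := dunklForm θ
  conj_inner_symm := dunklForm_conj_symm θ
  re_inner_nonneg f := by
    rcases eq_or_ne f 0 with rfl | h
    · simp [dunklForm]
    · exact (re_dunklForm_self_pos hθ h).le
  add_left := dunklForm_add_left θ
  smul_left f g c := dunklForm_smul_left θ c f g
  definite f hf := by
    by_contra h
    have := re_dunklForm_self_pos hθ h
    rw [hf] at this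
    simp at this

/-! ### The dominance order -/

theorem DomLE.refl (l : PartLE N) : DomLE l l := ⟨rfl, fun _ => le_rfl⟩

theorem DomLE.trans {l μ ν : PartLE N} (h : DomLE l μ) (h' : DomLE μ ν) : DomLE l ν :=
  ⟨h.1.trans h'.1, fun k => (h.2 k).trans (h'.2 k)⟩

/-- The sum of all partial sums of a partition. -/
def PartLE.rank (l : PartLE N) : ℕ := ∑ k, ∑ i ∈ Finset.Iic k, l.1 i

theorem DomLE.rank_le {μ l : PartLE N} (h : DomLE μ l) : μ.rank ≤ l.rank :=
  Finset.sum_le_sum fun k _ => h.2 k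

theorem eq_of_sum_Iic_eq {μ l : PartLE N}
    (h : ∀ k, ∑ i ∈ Finset.Iic k, μ.1 i = ∑ i ∈ Finset.Iic k, l.1 i) : μ = l := by
  apply Subtype.ext
  funext k
  induction k using WellFoundedLT.induction with
  | ind k ih =>
    have hk := h k
    have hs : ∑ i ∈ Finset.Iio k, μ.1 i = ∑ i ∈ Finset.Iio k, l.1 i :=
      Finset.sum_congr rfl fun i hi => ih i (Finset.mem_Iio.1 hi)
    rw [← Finset.Iio_insert k, Finset.sum_insert (by simp), Finset.sum_insert (by simp), hs] at hk
    exact Nat.add_right_cancel hk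

/-- This turns dominance into a strictly monotone natural number, on which the final triangularity
argument inducts. -/
theorem DomLE.rank_lt {μ l : PartLE N} (h : DomLE μ l) (hne : μ ≠ l) : μ.rank < l.rank := by
  refine h.rank_le.lt_of_ne fun h' => hne (eq_of_sum_Iic_eq fun k => ?_)
  exact (Finset.sum_eq_sum_iff_of_le fun k _ => h.2 k).1 h' k (Finset.mem_univ k)

theorem DomLE.antisymm {μ l : PartLE N} (h : DomLE μ l) (h' : DomLE l μ) : μ = l :=
  eq_of_sum_Iic_eq fun k => (h.2 k).antisymm (h'.2 k)

/-- Outside the common part, entries of `s` are at most `f k`, entries of the initial segment are at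
least `f k`, and there are equally many of each. -/
theorem sum_le_sum_Iic_of_antitone {f : Fin N → ℕ} (hf : Antitone f) (k : Fin N)
    {s : Finset (Fin N)} (hs : s.card = (Finset.Iic k).card) :
    ∑ i ∈ s, f i ≤ ∑ i ∈ Finset.Iic k, f i := by
  rw [← Finset.sum_inter_add_sum_sdiff s (Finset.Iic k),
    ← Finset.sum_inter_add_sum_sdiff (Finset.Iic k) s, Finset.inter_comm]
  refine Nat.add_le_add_left ?_ _
  calc ∑ i ∈ s \ Finset.Iic k, f i ≤ (s \ Finset.Iic k).card • f k :=
        Finset.sum_le_card_nsmul _ _ _ fun i hi => hf (by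
          simp only [Finset.mem_sdiff, Finset.mem_Iic, not_le] at hi
          exact hi.2.le)
    _ = (Finset.Iic k \ s).card • f k := by rw [Finset.card_sdiff_comm hs]
    _ ≤ ∑ i ∈ Finset.Iic k \ s, f i :=
        Finset.card_nsmul_le_sum _ _ _ fun i hi => hf (by
          simp only [Finset.mem_sdiff, Finset.mem_Iic] at hi
          exact hi.1)

theorem sortDesc_apply (γ : Fin N →₀ ℕ) (i : Fin N) :
    (sortDesc γ).1 i = γ (Tuple.sort (OrderDual.toDual ∘ γ) i) := rfl

theorem size_sortDesc (γ : Fin N →₀ ℕ) : (sortDesc γ).size = ∑ i, γ i := by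
  rw [PartLE.size]
  exact Fintype.sum_equiv (Tuple.sort (OrderDual.toDual ∘ γ)) _ _ fun _ => rfl

theorem sum_le_sum_Iic_sortDesc (γ : Fin N →₀ ℕ) (k : Fin N) {s : Finset (Fin N)}
    (hs : s.card = (Finset.Iic k).card) :
    ∑ i ∈ s, γ i ≤ ∑ i ∈ Finset.Iic k, (sortDesc γ).1 i := by
  have h := sum_le_sum_Iic_of_antitone (sortDesc γ).2 k
    (s := s.map (Tuple.sort (OrderDual.toDual ∘ γ)).symm.toEmbedding) (by rwa [Finset.card_map])
  rw [Finset.sum_map] at h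
  simpa [sortDesc_apply] using h

/-- Partial sums of the sorted sequence are the largest sums over subsets of given size, so
dominance can be tested without sorting. -/
theorem domLE_sortDesc_of_forall {γ' γ : Fin N →₀ ℕ} (hsum : ∑ i, γ' i = ∑ i, γ i)
    (h : ∀ s : Finset (Fin N), ∃ t : Finset (Fin N), t.card = s.card ∧
      ∑ i ∈ s, γ' i ≤ ∑ i ∈ t, γ i) : DomLE (sortDesc γ') (sortDesc γ) := by
  refine ⟨by rw [size_sortDesc, size_sortDesc, hsum], fun k => ?_⟩
  obtain ⟨t, ht, hle⟩ :=
    h ((Finset.Iic k).map (Tuple.sort (OrderDual.toDual ∘ γ')).toEmbedding)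
  rw [Finset.card_map] at ht
  rw [Finset.sum_map] at hle
  exact hle.trans (sum_le_sum_Iic_sortDesc γ k ht)

theorem exists_sum_le_of_two_point {γ' γ : Fin N →₀ ℕ} {i j : Fin N}
    (hne : ∀ k, k ≠ i → k ≠ j → γ' k = γ k) (hmax : γ' i ≤ max (γ i) (γ j))
    {s : Finset (Fin N)} (hi : i ∈ s) (hj : j ∉ s) :
    ∃ t : Finset (Fin N), t.card = s.card ∧ ∑ k ∈ s, γ' k ≤ ∑ k ∈ t, γ k := by
  have hrest : ∑ k ∈ s.erase i, γ' k = ∑ k ∈ s.erase i, γ k :=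
    Finset.sum_congr rfl fun k hk =>
      hne k (Finset.ne_of_mem_erase hk) fun h => hj (h ▸ Finset.mem_of_mem_erase hk)
  have hj' : j ∉ s.erase i := fun h => hj (Finset.mem_of_mem_erase h)
  rcases le_max_iff.1 hmax with h | h
  · refine ⟨s, rfl, ?_⟩
    rw [← Finset.add_sum_erase s _ hi, ← Finset.add_sum_erase s γ hi, hrest]
    omega
  · refine ⟨insert j (s.erase i), ?_, ?_⟩
    · rw [Finset.card_insert_of_notMem hj', Finset.card_erase_add_one hi]
    · rw [← Finset.add_sum_erase s _ hi, Finset.sum_insert hj', hrest]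
      omega

/-- Sets containing both or neither of `i`, `j` keep their sums. For a set containing exactly one,
that index is kept or exchanged for the other, whichever carries the maximum. -/
theorem domLE_sortDesc_of_two_point {γ' γ : Fin N →₀ ℕ} {i j : Fin N} (hij : i ≠ j)
    (hne : ∀ k, k ≠ i → k ≠ j → γ' k = γ k) (hadd : γ' i + γ' j = γ i + γ j)
    (hi : γ' i ≤ max (γ i) (γ j)) (hj : γ' j ≤ max (γ i) (γ j)) :
    DomLE (sortDesc γ') (sortDesc γ) := by
  have both : ∀ s : Finset (Fin N), i ∈ s → j ∈ s → ∑ k ∈ s, γ' k = ∑ k ∈ s, γ k := by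
    intro s his hjs
    have hjs' : j ∈ s.erase i := Finset.mem_erase.2 ⟨hij.symm, hjs⟩
    rw [← Finset.add_sum_erase s _ his, ← Finset.add_sum_erase _ _ hjs',
      ← Finset.add_sum_erase s γ his, ← Finset.add_sum_erase _ γ hjs', ← add_assoc, ← add_assoc,
      hadd]
    congr 1
    refine Finset.sum_congr rfl fun k hk => hne k ?_ (Finset.ne_of_mem_erase hk)
    exact Finset.ne_of_mem_erase (Finset.mem_of_mem_erase hk)
  refine domLE_sortDesc_of_forall (both _ (Finset.mem_univ i) (Finset.mem_univ j)) fun s => ?_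
  by_cases his : i ∈ s <;> by_cases hjs : j ∈ s
  · exact ⟨s, rfl, (both s his hjs).le⟩
  · exact exists_sum_le_of_two_point hne hi his hjs
  · exact exists_sum_le_of_two_point (fun k h h' => hne k h' h) (by rwa [max_comm]) hjs his
  · refine ⟨s, rfl, (Finset.sum_congr rfl fun k hk => hne k ?_ ?_).le⟩
    · rintro rfl; exact his hk
    · rintro rfl; exact hjs hk

/-! ### Triangularity -/

/-- The span of the monomials `x^γ` with `γ^+ ⪯ λ`. -/
def lowerSpan (l : PartLE N) : Submodule ℂ (Poly N) :=
  restrictSupport ℂ {γ | DomLE (sortDesc γ) l}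

/-- The span of the monomials `x^γ` with `γ^+ ≺ λ`. -/
def strictLowerSpan (l : PartLE N) : Submodule ℂ (Poly N) :=
  restrictSupport ℂ {γ | DomLE (sortDesc γ) l ∧ sortDesc γ ≠ l}

theorem mem_lowerSpan {l : PartLE N} {f : Poly N} :
    f ∈ lowerSpan l ↔ ∀ γ ∈ f.support, DomLE (sortDesc γ) l := Iff.rfl

theorem mem_strictLowerSpan {l : PartLE N} {f : Poly N} :
    f ∈ strictLowerSpan l ↔ ∀ γ ∈ f.support, DomLE (sortDesc γ) l ∧ sortDesc γ ≠ l := Iff.rfl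

theorem monomial_mem_lowerSpan {l : PartLE N} {γ : Fin N →₀ ℕ} (h : DomLE (sortDesc γ) l) (a : ℂ) :
    monomial γ a ∈ lowerSpan l :=
  (monomial_mem_restrictSupport ℂ).2 (Or.inl h)

theorem lowerSpan_mono {μ l : PartLE N} (h : DomLE μ l) : lowerSpan μ ≤ lowerSpan l :=
  fun _ hf => mem_lowerSpan.2 fun γ hγ => (mem_lowerSpan.1 hf γ hγ).trans h

theorem lowerSpan_le_strictLowerSpan {μ l : PartLE N} (h : DomLE μ l) (hne : μ ≠ l) :
    lowerSpan μ ≤ strictLowerSpan l := fun _ hf => mem_strictLowerSpan.2 fun γ hγ =>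
  have h' := mem_lowerSpan.1 hf γ hγ
  ⟨h'.trans h, fun h'' => hne (h.antisymm (h'' ▸ h'))⟩

theorem divDiff_mul_of_permRep_eq {i j : Fin N} (h : i ≠ j) {p : Poly N}
    (hp : permRep N (Equiv.swap i j) p = p) (q : Poly N) :
    divDiff h (p * q) = p * divDiff h q := by
  apply divDiff_eq_of_eq_mul
  have : permRep N (Equiv.swap i j) (p * q) = p * permRep N (Equiv.swap i j) q := by
    conv_rhs => rw [← hp]
    simp [permRep_apply]
  rw [this]
  linear_combination p * divDiff_spec h q

theorem divDiff_X_pow_left {i j : Fin N} (h : i ≠ j) (c : ℕ) :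
    divDiff h (X i ^ c) = ∑ k ∈ Finset.range c, X i ^ k * X j ^ (c - 1 - k) := by
  apply divDiff_eq_of_eq_mul
  rw [mul_comm, geom_sum₂_mul]
  simp [permRep_apply]

theorem divDiff_X_pow_right {i j : Fin N} (h : i ≠ j) (c : ℕ) :
    divDiff h (X j ^ c) = -∑ k ∈ Finset.range c, X i ^ k * X j ^ (c - 1 - k) := by
  apply divDiff_eq_of_eq_mul
  rw [mul_comm, neg_mul, geom_sum₂_mul]
  simp [permRep_apply]

theorem permRep_swap_monomial_of_eq {i j : Fin N} {δ : Fin N →₀ ℕ} (h : δ i = δ j) (c : ℂ) :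
    permRep N (Equiv.swap i j) (monomial δ c) = monomial δ c := by
  rw [permRep_apply, rename_monomial]
  refine congrArg (fun δ => monomial δ c) (Finsupp.ext fun a => ?_)
  rw [Finsupp.mapDomain_equiv_apply, Equiv.symm_swap, Equiv.swap_apply_def]
  split_ifs with h1 h2
  · rw [h1, h]
  · rw [h2, h]
  · rfl

/-- Above the common value `δ i = δ j`, the exponents at `i` and `j` become `k + 1` and `c - 1 - k`:
their sum is `c`, and neither exceeds `c` because `k < c`. -/
theorem X_mul_monomial_mul_geom_mem {i j : Fin N} (hij : i ≠ j) {δ γ : Fin N →₀ ℕ} {c : ℕ}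
    (hδ : δ i = δ j) (hγ : γ = δ + Finsupp.single i c ∨ γ = δ + Finsupp.single j c) (a : ℂ) :
    X i * (monomial δ a * ∑ k ∈ Finset.range c, X i ^ k * X j ^ (c - 1 - k)) ∈
      lowerSpan (sortDesc γ) := by
  rw [Finset.mul_sum, Finset.mul_sum]
  refine sum_mem fun k hk => ?_
  rw [Finset.mem_range] at hk
  have : X i * (monomial δ a * (X i ^ k * X j ^ (c - 1 - k))) =
      monomial (δ + Finsupp.single i (k + 1) + Finsupp.single j (c - 1 - k)) a := by
    rw [monomial_add_single, monomial_add_single, pow_succ]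
    ring
  rw [this]
  refine monomial_mem_lowerSpan ?_ a
  apply domLE_sortDesc_of_two_point hij
  · intro m hm hm'
    rcases hγ with rfl | rfl <;> simp [hm, hm']
  all_goals
    rcases hγ with rfl | rfl <;>
      simp only [Finsupp.add_apply, Finsupp.single_apply, hij, hij.symm, hδ, if_true, if_false] <;>
      omega

theorem X_mul_divDiff_monomial_mem {i j : Fin N} (hij : i ≠ j) (γ : Fin N →₀ ℕ) (a : ℂ) :
    X i * divDiff hij (monomial γ a) ∈ lowerSpan (sortDesc γ) := by
  rcases le_total (γ j) (γ i) with h | h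
  -- Lowering the larger of the two exponents to the smaller leaves a monomial fixed by the
  -- transposition, which factors out of the divided difference.
  · obtain ⟨δ, hδ, hγ⟩ : ∃ δ : Fin N →₀ ℕ, δ i = δ j ∧
        γ = δ + Finsupp.single i (γ i - γ j) := by
      refine ⟨γ - Finsupp.single i (γ i - γ j), ?_, ?_⟩
      · simp [hij]
        omega
      · ext m
        simp only [Finsupp.add_apply, Finsupp.tsub_apply, Finsupp.single_apply]
        split_ifs with hm
        · subst hm; omega
        · simp
    have h1 : divDiff hij (monomial γ a) = monomial δ a *
        ∑ k ∈ Finset.range (γ i - γ j), X i ^ k * X j ^ (γ i - γ j - 1 - k) := by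
      conv_lhs => rw [hγ]
      rw [monomial_add_single, divDiff_mul_of_permRep_eq hij (permRep_swap_monomial_of_eq hδ a),
        divDiff_X_pow_left]
    rw [h1]
    exact X_mul_monomial_mul_geom_mem hij hδ (Or.inl hγ) a
  · obtain ⟨δ, hδ, hγ⟩ : ∃ δ : Fin N →₀ ℕ, δ i = δ j ∧
        γ = δ + Finsupp.single j (γ j - γ i) := by
      refine ⟨γ - Finsupp.single j (γ j - γ i), ?_, ?_⟩
      · simp [hij.symm]
        omega
      · ext m
        simp only [Finsupp.add_apply, Finsupp.tsub_apply, Finsupp.single_apply]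
        split_ifs with hm
        · subst hm; omega
        · simp
    have h1 : divDiff hij (monomial γ a) = -(monomial δ a *
        ∑ k ∈ Finset.range (γ j - γ i), X i ^ k * X j ^ (γ j - γ i - 1 - k)) := by
      conv_lhs => rw [hγ]
      rw [monomial_add_single, divDiff_mul_of_permRep_eq hij (permRep_swap_monomial_of_eq hδ a),
        divDiff_X_pow_right, mul_neg]
    rw [h1, mul_neg]
    exact neg_mem (X_mul_monomial_mul_geom_mem hij hδ (Or.inr hγ) a)

theorem xDunkl_monomial_mem (θ : ℝ) (i : Fin N) (γ : Fin N →₀ ℕ) (a : ℂ) :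
    xDunkl θ i (monomial γ a) ∈ lowerSpan (sortDesc γ) := by
  rw [xDunkl_apply, dunkl_apply, mul_add, mul_smul_comm, Finset.mul_sum]
  refine add_mem ?_ (Submodule.smul_mem _ _ (sum_mem fun j _ => X_mul_divDiff_monomial_mem j.2 γ a))
  rw [X_mul_pderiv_monomial]
  refine Submodule.smul_of_tower_mem _ _ ?_
  exact monomial_mem_lowerSpan (DomLE.refl _) a

theorem map_mem_of_monomial {T : Module.End ℂ (Poly N)} {W : Submodule ℂ (Poly N)} {f : Poly N}
    (hT : ∀ γ ∈ f.support, ∀ a, T (monomial γ a) ∈ W) : T f ∈ W := by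
  rw [f.as_sum, map_sum]
  exact sum_mem fun γ hγ => hT γ hγ _

theorem xDunkl_mem_lowerSpan (θ : ℝ) (i : Fin N) {l : PartLE N} {f : Poly N}
    (hf : f ∈ lowerSpan l) : xDunkl θ i f ∈ lowerSpan l :=
  map_mem_of_monomial fun γ hγ a =>
    lowerSpan_mono (mem_lowerSpan.1 hf γ hγ) (xDunkl_monomial_mem θ i γ a)

theorem xDunkl_mem_strictLowerSpan (θ : ℝ) (i : Fin N) {l : PartLE N} {f : Poly N}
    (hf : f ∈ strictLowerSpan l) : xDunkl θ i f ∈ strictLowerSpan l :=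
  map_mem_of_monomial fun γ hγ a =>
    have h := mem_strictLowerSpan.1 hf γ hγ
    lowerSpan_le_strictLowerSpan h.1 h.2 (xDunkl_monomial_mem θ i γ a)

theorem hpOp_mem (θ : ℝ) (m : ℕ) {W : Submodule ℂ (Poly N)}
    (hW : ∀ i, ∀ f ∈ W, xDunkl θ i f ∈ W) {f : Poly N} (hf : f ∈ W) : hpOp N θ m f ∈ W := by
  rw [hpOp, LinearMap.sum_apply]
  refine sum_mem fun i _ => ?_
  induction m with
  | zero => simpa using hf
  | succ m ih =>
    rw [pow_succ', Module.End.mul_apply]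
    exact hW i _ ih

theorem hpOp_mem_lowerSpan (θ : ℝ) (m : ℕ) {l : PartLE N} {f : Poly N}
    (hf : f ∈ lowerSpan l) : hpOp N θ m f ∈ lowerSpan l :=
  hpOp_mem θ m (fun i _ => xDunkl_mem_lowerSpan θ i) hf

theorem hpOp_mem_strictLowerSpan (θ : ℝ) (m : ℕ) {l : PartLE N} {f : Poly N}
    (hf : f ∈ strictLowerSpan l) : hpOp N θ m f ∈ strictLowerSpan l :=
  hpOp_mem θ m (fun i _ => xDunkl_mem_strictLowerSpan θ i) hf

theorem isHomogeneous_of_mem_lowerSpan {l : PartLE N} {f : Poly N} (hf : f ∈ lowerSpan l) :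
    f.IsHomogeneous l.size := by
  intro γ hγ
  have h : DomLE (sortDesc γ) l := mem_lowerSpan.1 hf γ (mem_support_iff.2 hγ)
  rw [← h.1, size_sortDesc, ← Finsupp.degree_eq_sum, Finsupp.degree_eq_weight_one]
  rfl

theorem strictLowerSpan_le_lowerSpan (l : PartLE N) : strictLowerSpan l ≤ lowerSpan l :=
  restrictSupport_mono _ fun _ h => h.1

instance finiteDimensional_lowerSpan (l : PartLE N) : FiniteDimensional ℂ (lowerSpan l) :=
  have : FiniteDimensional ℂ (homogeneousSubmodule (Fin N) ℂ l.size) :=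
    Module.Finite.iff_fg.2 (homogeneousSubmodule_fg _ _ _)
  Submodule.finiteDimensional_of_le (S₂ := homogeneousSubmodule (Fin N) ℂ l.size)
    fun _ hf => isHomogeneous_of_mem_lowerSpan hf

instance finiteDimensional_strictLowerSpan (l : PartLE N) :
    FiniteDimensional ℂ (strictLowerSpan l) :=
  Submodule.finiteDimensional_of_le (strictLowerSpan_le_lowerSpan l)

/-! ### Leading parts -/

theorem mem_V {l : PartLE N} {f : Poly N} : f ∈ V l ↔ ∀ γ ∈ f.support, sortDesc γ = l := by
  have h : V l = restrictSupport ℂ {γ | sortDesc γ = l} := by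
    rw [restrictSupport_eq_span, V]
    refine congrArg _ (Set.ext fun f => ⟨?_, ?_⟩)
    · rintro ⟨γ, hγ, rfl⟩
      exact ⟨γ, hγ, rfl⟩
    · rintro ⟨γ, hγ, rfl⟩
      exact ⟨γ, hγ, rfl⟩
  rw [h]
  exact Iff.rfl

theorem V_le_lowerSpan (l : PartLE N) : V l ≤ lowerSpan l := fun _ hf =>
  mem_lowerSpan.2 fun γ hγ => mem_V.1 hf γ hγ ▸ DomLE.refl _

theorem coeff_partIn (l : PartLE N) (f : Poly N) (γ : Fin N →₀ ℕ) [Decidable (sortDesc γ = l)] :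
    coeff γ (partIn l f) = if sortDesc γ = l then coeff γ f else 0 := by
  classical
  rw [partIn, coeff_sum]
  simp only [coeff_monomial, Finset.sum_ite_eq', Finset.mem_filter, mem_support_iff]
  by_cases h : sortDesc γ = l <;> by_cases h' : coeff γ f = 0 <;> simp [h, h']

/-- The projection onto `V_λ` along the monomials outside `V_λ`. -/
def partInₗ (l : PartLE N) : Poly N →ₗ[ℂ] Poly N where
  toFun := partIn l
  map_add' f g := by
    classical
    ext γ
    simp only [coeff_partIn, coeff_add]
    split_ifs <;> simp
  map_smul' c f := by
    classical
    ext γ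
    simp only [coeff_partIn, coeff_smul, RingHom.id_apply]
    split_ifs <;> simp

theorem partInₗ_apply (l : PartLE N) (f : Poly N) : partInₗ l f = partIn l f := rfl

theorem partIn_mem_V (l : PartLE N) (f : Poly N) : partIn l f ∈ V l := by
  classical
  refine mem_V.2 fun γ hγ => ?_
  rw [mem_support_iff, coeff_partIn] at hγ
  by_contra h
  exact hγ (if_neg h)

theorem partIn_eq_self {l : PartLE N} {f : Poly N} (hf : f ∈ V l) : partIn l f = f := by
  classical
  ext γ
  rw [coeff_partIn]
  split_ifs with h
  · rfl
  · by_contra h'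
    exact h (mem_V.1 hf γ (mem_support_iff.2 (Ne.symm h')))

theorem partIn_eq_zero_of_mem_strictLowerSpan {l : PartLE N} {f : Poly N}
    (hf : f ∈ strictLowerSpan l) : partIn l f = 0 := by
  classical
  ext γ
  rw [coeff_partIn, coeff_zero]
  split_ifs with h
  · by_contra h'
    exact (mem_strictLowerSpan.1 hf γ (mem_support_iff.2 h')).2 h
  · rfl

theorem sub_partIn_mem_strictLowerSpan {l : PartLE N} {f : Poly N} (hf : f ∈ lowerSpan l) :
    f - partIn l f ∈ strictLowerSpan l := by
  classical
  refine mem_strictLowerSpan.2 fun γ hγ => ?_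
  rw [mem_support_iff, coeff_sub, coeff_partIn] at hγ
  split_ifs at hγ with h
  · simp at hγ
  · exact ⟨mem_lowerSpan.1 hf γ (mem_support_iff.2 (by simpa using hγ)), h⟩

theorem permRep_partIn (σ : Equiv.Perm (Fin N)) (l : PartLE N) (f : Poly N) :
    permRep N σ (partIn l f) = partIn l (permRep N σ f) := by
  classical
  ext γ
  obtain ⟨δ, rfl⟩ : ∃ δ : Fin N →₀ ℕ, γ = δ.mapDomain σ :=
    ⟨γ.mapDomain σ.symm, by
      rw [← Finsupp.mapDomain_comp, Equiv.self_comp_symm, Finsupp.mapDomain_id]⟩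
  rw [coeff_partIn, permRep_apply, permRep_apply, coeff_rename_mapDomain _ σ.injective,
    coeff_rename_mapDomain _ σ.injective, coeff_partIn, sortDesc_mapDomain]

/-! ### Isotypic decomposition -/

section Rep

variable {G : Type*} [Monoid G] {W W' : Type*} [AddCommGroup W] [Module ℂ W] [AddCommGroup W']
  [Module ℂ W'] {ρ : Representation ℂ G W} {σ : Representation ℂ G W'}

theorem nonempty_repEquiv_iff :
    Nonempty (ρ.Equiv σ) ↔ Nonempty (ρ.asModule ≃ₗ[ℂ[G]] σ.asModule) := by
  constructor
  · rintro ⟨e⟩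
    exact ⟨LinearEquiv.ofBijective
      (Representation.IntertwiningMap.equivLinearMapAsModule ρ σ e.toIntertwiningMap)
      e.toLinearEquiv.bijective⟩
  · rintro ⟨e⟩
    exact ⟨((Representation.IntertwiningMap.equivLinearMapAsModule ρ σ).symm
      e.toLinearMap).ofBijective e.bijective⟩

end Rep

/-- The group algebra module attached to an isomorphism class of irreducible representations. -/
abbrev IrrepClass.asModule (τ : IrrepClass N) : Type := (Quotient.out τ).rep.asModule

instance (τ : IrrepClass N) : IsSimpleModule ℂ[Equiv.Perm (Fin N)] τ.asModule :=
  (Representation.irreducible_iff_isSimpleModule_asModule _).1 (Quotient.out τ).irreducible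

theorem IrrepClass.eq_of_linearEquiv {τ τ' : IrrepClass N}
    (e : τ.asModule ≃ₗ[ℂ[Equiv.Perm (Fin N)]] τ'.asModule) : τ = τ' := by
  rw [← Quotient.out_eq τ, ← Quotient.out_eq τ']
  exact Quotient.sound (nonempty_repEquiv_iff.2 ⟨e⟩)

theorem IrrepClass.exists_linearEquiv_rep {W : Type} [AddCommGroup W] [Module ℂ W]
    (ρ : Representation ℂ (Equiv.Perm (Fin N)) W) (hρ : ρ.IsIrreducible) :
    ∃ τ : IrrepClass N, Nonempty (ρ.asModule ≃ₗ[ℂ[Equiv.Perm (Fin N)]] τ.asModule) := by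
  obtain ⟨e⟩ := (nonempty_repEquiv_iff (σ := ρ)).1
    (Quotient.mk_out (s := Irrep.setoid N) ⟨W, ρ, hρ⟩)
  exact ⟨Quotient.mk _ ⟨W, ρ, hρ⟩, ⟨e.symm⟩⟩

/-- Restricting scalars to `ℂ` turns the simple module into a representation whose associated module
is again `S`. -/
theorem IrrepClass.exists_linearEquiv (S : Type) [AddCommGroup S]
    [Module ℂ[Equiv.Perm (Fin N)] S] [IsSimpleModule ℂ[Equiv.Perm (Fin N)] S] :
    ∃ τ : IrrepClass N, Nonempty (S ≃ₗ[ℂ[Equiv.Perm (Fin N)]] τ.asModule) := by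
  let _ : Module ℂ S := Module.compHom S (algebraMap ℂ ℂ[Equiv.Perm (Fin N)])
  have hsmul : ∀ (c : ℂ) (x : S), c • x = algebraMap ℂ ℂ[Equiv.Perm (Fin N)] c • x :=
    fun _ _ => rfl
  let ρ : Representation ℂ (Equiv.Perm (Fin N)) S :=
    { toFun g :=
        { toFun x := MonoidAlgebra.of ℂ _ g • x
          map_add' := smul_add _
          map_smul' c x := by
            rw [RingHom.id_apply, hsmul, hsmul, smul_smul, smul_smul, Algebra.commutes] }
      map_one' := LinearMap.ext fun x => by
        change MonoidAlgebra.of ℂ (Equiv.Perm (Fin N)) 1 • x = x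
        rw [map_one, one_smul]
      map_mul' g h := LinearMap.ext fun x => by
        change MonoidAlgebra.of ℂ _ (g * h) • x =
          MonoidAlgebra.of ℂ _ g • MonoidAlgebra.of ℂ _ h • x
        rw [map_mul, mul_smul] }
  have hρ : ∀ g x, ρ g x = MonoidAlgebra.of ℂ _ g • x := fun _ _ => rfl
  let e : ρ.asModule ≃ₗ[ℂ[Equiv.Perm (Fin N)]] S :=
    { ρ.asModuleEquiv.toAddEquiv with
      map_smul' := fun r x => by
        change ρ.asModuleEquiv (r • x) = r • ρ.asModuleEquiv x
        rw [Representation.asModuleEquiv_map_smul]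
        induction r using MonoidAlgebra.induction_on with
        | of g => rw [Representation.asAlgebraHom_of, hρ]
        | add a b ha hb => rw [map_add, LinearMap.add_apply, ha, hb, add_smul]
        | smul c a ha => rw [map_smul, LinearMap.smul_apply, ha, hsmul, smul_smul,
            Algebra.smul_def] }
  have := IsSimpleModule.congr e
  obtain ⟨τ, ⟨e'⟩⟩ := IrrepClass.exists_linearEquiv_rep ρ
    ((Representation.irreducible_iff_isSimpleModule_asModule ρ).2 this)
  exact ⟨τ, ⟨e.symm.trans e'⟩⟩

section Module

variable (M : Type) [AddCommGroup M] [Module ℂ[Equiv.Perm (Fin N)] M]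

/-- A nonzero intersection would, by semisimplicity, contain a simple submodule isomorphic to two
distinct classes. -/
theorem iSupIndep_isotypicComponent :
    iSupIndep fun τ : IrrepClass N =>
      isotypicComponent ℂ[Equiv.Perm (Fin N)] M τ.asModule := by
  intro τ
  rw [disjoint_iff]
  by_contra hne
  obtain ⟨S, hS, _⟩ := (IsSemisimpleModule.eq_bot_or_exists_simple_le _).resolve_left hne
  obtain ⟨e⟩ := isIsotypicOfType_submodule_iff.1
    (IsIsotypicOfType.isotypicComponent ℂ[Equiv.Perm (Fin N)] M τ.asModule) S
    (hS.trans inf_le_left)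
  have hle : S ≤ sSup {C | ∃ τ' : IrrepClass N, τ' ≠ τ ∧
      isotypicComponent ℂ[Equiv.Perm (Fin N)] M τ'.asModule = C} :=
    (hS.trans inf_le_right).trans (iSup₂_le fun τ' h => le_sSup ⟨τ', h, rfl⟩)
  obtain ⟨_, ⟨τ', hτ', rfl⟩, S', hS', ⟨e'⟩⟩ := S.le_linearEquiv_of_le_sSup _ hle
  have := IsSimpleModule.congr e'.symm
  obtain ⟨e''⟩ := isIsotypicOfType_submodule_iff.1
    (IsIsotypicOfType.isotypicComponent ℂ[Equiv.Perm (Fin N)] M τ'.asModule) S' hS'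
  exact hτ' (IrrepClass.eq_of_linearEquiv ((e''.symm.trans e'.symm).trans e))

theorem iSup_isotypicComponent :
    ⨆ τ : IrrepClass N, isotypicComponent ℂ[Equiv.Perm (Fin N)] M τ.asModule = ⊤ := by
  rw [eq_top_iff, ← IsSemisimpleModule.sSup_simples_eq_top]
  refine sSup_le fun S hS => ?_
  have : IsSimpleModule ℂ[Equiv.Perm (Fin N)] S := hS
  obtain ⟨τ, e⟩ := IrrepClass.exists_linearEquiv (N := N) S
  exact le_iSup_of_le τ (le_sSup e)

end Module

/-- The inclusion of `V_λ`, as a module over the group algebra, into the polynomials. -/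
def VIncl (l : PartLE N) : (VRep l).toRepresentation.asModule →ₗ[ℂ] Poly N :=
  (V l).subtype ∘ₗ (VRep l).toRepresentation.asModuleEquiv.toLinearMap

theorem VIncl_injective (l : PartLE N) : Function.Injective (VIncl l) :=
  (V l).subtype_injective.comp (VRep l).toRepresentation.asModuleEquiv.injective

theorem VIncl_mem (l : PartLE N) (x) : VIncl l x ∈ V l :=
  ((VRep l).toRepresentation.asModuleEquiv x).2

theorem exists_VIncl_eq {l : PartLE N} {f : Poly N} (hf : f ∈ V l) : ∃ x, VIncl l x = f :=
  ⟨(VRep l).toRepresentation.asModuleEquiv.symm ⟨f, hf⟩, rfl⟩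

theorem mem_isotypic {l : PartLE N} {τ : IrrepClass N} {f : Poly N} :
    f ∈ isotypic l τ ↔ ∃ x ∈ isotypicComponent ℂ[Equiv.Perm (Fin N)]
      (VRep l).toRepresentation.asModule τ.asModule, VIncl l x = f := Iff.rfl

theorem isotypic_le_V (l : PartLE N) (τ : IrrepClass N) : isotypic l τ ≤ V l := by
  intro f hf
  obtain ⟨x, _, rfl⟩ := mem_isotypic.1 hf
  exact VIncl_mem l x

/-- An equivariant map is linear over the group algebra, and isotypic components are stable under
every module endomorphism. -/
theorem map_mem_isotypic {l : PartLE N} {τ : IrrepClass N} (Q : Poly N →ₗ[ℂ] Poly N)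
    (hV : ∀ f ∈ V l, Q f ∈ V l) (hQ : ∀ σ f, permRep N σ (Q f) = Q (permRep N σ f))
    {f : Poly N} (hf : f ∈ isotypic l τ) : Q f ∈ isotypic l τ := by
  obtain ⟨x, hx, rfl⟩ := mem_isotypic.1 hf
  let q : (VRep l).toRepresentation.IntertwiningMap (VRep l).toRepresentation :=
    ⟨Q.restrict hV, fun σ => LinearMap.ext fun x => Subtype.ext (hQ σ x).symm⟩
  let q' : Module.End ℂ[Equiv.Perm (Fin N)] (VRep l).toRepresentation.asModule :=
    Representation.IntertwiningMap.equivLinearMapAsModule _ _ q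
  have h := Submodule.IsFullyInvariant.isotypicComponent
    ℂ[Equiv.Perm (Fin N)] (VRep l).toRepresentation.asModule τ.asModule q' hx
  exact mem_isotypic.2 ⟨q' x, h, rfl⟩

theorem eq_zero_of_sum_isotypic_eq_zero {l : PartLE N} (s : Finset (IrrepClass N))
    (v : IrrepClass N → Poly N) (hv : ∀ τ ∈ s, v τ ∈ isotypic l τ) (h0 : ∑ τ ∈ s, v τ = 0) :
    ∀ τ ∈ s, v τ = 0 := by
  have hw : ∀ τ, ∃ x, τ ∈ s → x ∈ isotypicComponent ℂ[Equiv.Perm (Fin N)]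
      (VRep l).toRepresentation.asModule τ.asModule ∧ VIncl l x = v τ := by
    intro τ
    by_cases h : τ ∈ s
    · obtain ⟨x, hx⟩ := mem_isotypic.1 (hv τ h)
      exact ⟨x, fun _ => hx⟩
    · exact ⟨0, fun h' => absurd h' h⟩
  choose w hw using hw
  have key := (iSupIndep_iff_finsetSum_eq_zero_imp_eq_zero _).1
    (iSupIndep_isotypicComponent (N := N) (VRep l).toRepresentation.asModule) s w
    (fun τ h => (hw τ h).1) ?_
  · intro τ h
    rw [← (hw τ h).2, key τ h, map_zero]
  · apply VIncl_injective
    rw [map_sum, map_zero, ← h0]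
    exact Finset.sum_congr rfl fun τ h => (hw τ h).2

theorem V_le_iSup_isotypic (l : PartLE N) : V l ≤ ⨆ τ, isotypic l τ := by
  intro f hf
  obtain ⟨x, rfl⟩ := exists_VIncl_eq hf
  have h : x ∈ ⨆ τ : IrrepClass N, isotypicComponent ℂ[Equiv.Perm (Fin N)]
      (VRep l).toRepresentation.asModule τ.asModule := by
    rw [iSup_isotypicComponent]
    exact Submodule.mem_top
  refine Submodule.iSup_induction _
    (motive := fun x => VIncl l x ∈ ⨆ τ, isotypic l τ) h ?_ ?_ ?_
  · intro τ x hx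
    exact Submodule.mem_iSup_of_mem τ (mem_isotypic.2 ⟨x, hx, rfl⟩)
  · rw [map_zero]
    exact zero_mem _
  · intro x y hx hy
    rw [map_add]
    exact add_mem hx hy

/-! ### Joint eigenbases -/

/-- The space is the direct sum of joint eigenspaces, so bases of these are collected; the first
component of a collected index is the family of eigenvalues. -/
theorem exists_joint_eigenbasis {E : Type*} [NormedAddCommGroup E] [InnerProductSpace ℂ E]
    [FiniteDimensional ℂ E] {ι : Type*} {T : ι → E →ₗ[ℂ] E} (hT : ∀ j, (T j).IsSymmetric)
    (hC : ∀ j k, Commute (T j) (T k)) :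
    ∃ (b : Module.Basis (Fin (Module.finrank ℂ E)) ℂ E) (χ : Fin (Module.finrank ℂ E) → ι → ℂ),
      ∀ i j, T j (b i) = χ i j • b i := by
  classical
  have hI := LinearMap.IsSymmetric.directSum_isInternal_of_pairwise_commute hT
    fun j k _ => hC j k
  let b := hI.collectedBasis fun χ => Module.finBasis ℂ _
  let e := b.indexEquiv (Module.finBasis ℂ E)
  refine ⟨b.reindex e, fun i => (e.symm i).1, fun i j => ?_⟩
  rw [Module.Basis.reindex_apply]
  have := hI.collectedBasis_mem (fun χ => Module.finBasis ℂ _) (e.symm i)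
  exact Module.End.mem_eigenspace_iff.1 (Submodule.mem_iInf _ |>.1 this j)

/-- Here `K ≤ L` are the strictly lower and the lower span, `π` takes leading parts, and `A` is the
isotypic component. Self-adjointness replaces any separation of eigenvalues between `K` and the
leading part. -/
theorem exists_joint_eigenbasis_lift {E : Type*} [AddCommGroup E] [Module ℂ E]
    (c : InnerProductSpace.Core ℂ E) {ι : Type*} {T : ι → E →ₗ[ℂ] E}
    (hT : ∀ j x y, c.inner (T j x) y = c.inner x (T j y)) (hC : ∀ j k, Commute (T j) (T k))
    {L K A : Submodule ℂ E} [FiniteDimensional ℂ L] [FiniteDimensional ℂ K] (hKL : K ≤ L)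
    (hTL : ∀ j, ∀ x ∈ L, T j x ∈ L) (hTK : ∀ j, ∀ x ∈ K, T j x ∈ K) (π : E →ₗ[ℂ] E)
    (hπK : ∀ x ∈ K, π x = 0) (hπL : ∀ x ∈ L, π x = 0 → x ∈ K) (hAL : A ≤ L)
    (hπA : ∀ x ∈ A, π x = x) (hTA : ∀ j, ∀ x ∈ L, π x ∈ A → π (T j x) ∈ A) :
    ∃ (F : Fin (Module.finrank ℂ A) → E) (χ : Fin (Module.finrank ℂ A) → ι → ℂ),
      (∀ i j, T j (F i) = χ i j • F i) ∧ (∀ i, F i ∈ L) ∧ (∀ i, π (F i) ∈ A) ∧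
      LinearIndependent ℂ (fun i => π (F i)) ∧
      A ≤ Submodule.span ℂ (Set.range fun i => π (F i)) := by
  let _ : NormedAddCommGroup E := c.toNormedAddCommGroup
  let _ : InnerProductSpace ℂ E := InnerProductSpace.ofCore c.toCore
  have hT' : ∀ j, (T j).IsSymmetric := hT
  -- `π` restricts to an isomorphism from `W` onto `A`: its kernel on `L` is contained in `K`, which
  -- meets its orthogonal complement trivially.
  let W : Submodule ℂ E := L ⊓ Kᗮ ⊓ A.comap π
  have hTW : ∀ j, ∀ x ∈ W, T j x ∈ W := by
    rintro j x ⟨⟨hL, hK⟩, hA⟩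
    refine ⟨⟨hTL j x hL, ?_⟩, hTA j x hL hA⟩
    refine (Submodule.mem_orthogonal _ _).2 fun k hk => ?_
    rw [← hT' j k x]
    exact (Submodule.mem_orthogonal _ _).1 hK _ (hTK j k hk)
  have : FiniteDimensional ℂ W :=
    Submodule.finiteDimensional_of_le (S₂ := L) (inf_le_left.trans inf_le_left)
  let p : W →ₗ[ℂ] A := π.restrict fun x hx => hx.2
  have hp : Function.Bijective p := by
    constructor
    · rw [← LinearMap.ker_eq_bot, LinearMap.ker_eq_bot']
      rintro ⟨x, ⟨hL, hK⟩, hA⟩ hx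
      have hx0 : x ∈ K := hπL x hL (congrArg Subtype.val hx)
      have : x ∈ K ⊓ Kᗮ := ⟨hx0, hK⟩
      rw [Submodule.inf_orthogonal_eq_bot, Submodule.mem_bot] at this
      exact Subtype.ext this
    · rintro ⟨x, hx⟩
      -- A preimage of `x` is `x` minus its orthogonal projection to `K`, since `π` kills `K`.
      have hmem : K.starProjection x ∈ K := Submodule.starProjection_apply_mem K x
      have hpi : π (x - K.starProjection x) = x := by
        rw [map_sub, hπA x hx, hπK _ hmem, sub_zero]
      refine ⟨⟨x - K.starProjection x, ⟨sub_mem (hAL hx) (hKL hmem),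
        Submodule.sub_starProjection_mem_orthogonal x⟩, ?_⟩, Subtype.ext hpi⟩
      change π (x - K.starProjection x) ∈ A
      rwa [hpi]
  let e : W ≃ₗ[ℂ] A := LinearEquiv.ofBijective p hp
  obtain ⟨b, χ, hb⟩ := exists_joint_eigenbasis (T := fun j => (T j).restrict (hTW j))
    (fun j => (hT' j).restrict_invariant (hTW j))
    (fun j k => LinearMap.ext fun x => Subtype.ext (LinearMap.congr_fun (hC j k) x.1))
  let b' := b.reindex (finCongr e.finrank_eq)
  let bA := b'.map e
  have hbA : (fun i => π (b' i : E)) = A.subtype ∘ bA := rfl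
  refine ⟨fun i => b' i, fun i => χ ((finCongr e.finrank_eq).symm i), ?_, ?_, ?_, ?_, ?_⟩
  · intro i j
    have := congrArg Subtype.val (hb ((finCongr e.finrank_eq).symm i) j)
    simpa [b'] using this
  · exact fun i => (b' i).2.1.1
  · exact fun i => (b' i).2.2
  · rw [hbA]
    exact bA.linearIndependent.map' _ (Submodule.ker_subtype _)
  · rw [hbA, Set.range_comp, ← Submodule.map_span, bA.span_eq, Submodule.map_top,
      Submodule.range_subtype]

theorem exists_eigenfunctions {θ : ℝ} (hθ : 0 < θ) (l : PartLE N) (τ : IrrepClass N) :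
    ∃ (F : Fin (Module.finrank ℂ (isotypic l τ)) → Poly N)
      (χ : Fin (Module.finrank ℂ (isotypic l τ)) → ℕ → ℂ),
      (∀ i m, hpOp N θ m (F i) = χ i m • F i) ∧ (∀ i, F i ∈ lowerSpan l) ∧
      (∀ i, partIn l (F i) ∈ isotypic l τ) ∧
      LinearIndependent ℂ (fun i => partIn l (F i)) ∧
      isotypic l τ ≤ Submodule.span ℂ (Set.range fun i => partIn l (F i)) := by
  refine exists_joint_eigenbasis_lift (dunklCore N hθ) (T := hpOp N θ) (dunklForm_hpOp θ)
    (hpOp_commute N θ) (strictLowerSpan_le_lowerSpan l)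
    (fun m f => hpOp_mem_lowerSpan θ m) (fun m f => hpOp_mem_strictLowerSpan θ m) (partInₗ l)
    (fun f hf => partIn_eq_zero_of_mem_strictLowerSpan hf) ?_
    ((isotypic_le_V l τ).trans (V_le_lowerSpan l))
    (fun f hf => partIn_eq_self (isotypic_le_V l τ hf)) ?_
  · intro f hf h0
    have := sub_partIn_mem_strictLowerSpan hf
    rwa [← partInₗ_apply, h0, sub_zero] at this
  · intro m f hf hA
    -- The strictly lower part of `f` stays strictly lower, so the leading part of `P_m f` depends
    -- only on that of `f`, through an equivariant map.
    have h1 : partInₗ l (hpOp N θ m f) = (partInₗ l ∘ₗ hpOp N θ m) (partInₗ l f) := by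
      have := partIn_eq_zero_of_mem_strictLowerSpan
        (hpOp_mem_strictLowerSpan θ m (sub_partIn_mem_strictLowerSpan hf))
      rw [← partInₗ_apply, map_sub, map_sub, sub_eq_zero] at this
      exact this
    rw [h1]
    refine map_mem_isotypic _ (fun f _ => partIn_mem_V l _) (fun σ f => ?_) hA
    rw [LinearMap.comp_apply, LinearMap.comp_apply, partInₗ_apply, partInₗ_apply, permRep_partIn,
      permRep_hpOp]

/-! ### The basis of eigenfunctions -/

theorem iSupIndep_isotypic :
    iSupIndep fun p : PartLE N × IrrepClass N => isotypic p.1 p.2 := by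
  classical
  rw [iSupIndep_iff_finsetSum_eq_zero_imp_eq_zero]
  intro s v hv h0 p hp
  -- Projecting the relation to the monomials of `V_λ`, with `λ = p.1`, isolates the terms with this
  -- partition; independence over `τ` then finishes.
  have h1 : ∑ q ∈ s with q.1 = p.1, v q = 0 := by
    have := congrArg (partInₗ p.1) h0
    rw [map_sum, map_zero] at this
    rw [← this, Finset.sum_filter]
    refine Finset.sum_congr rfl fun q hq => ?_
    have hq' := isotypic_le_V _ _ (hv q hq)
    split_ifs with h
    · rw [← h]
      exact (partIn_eq_self hq').symm
    · symm
      ext γ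
      rw [partInₗ_apply, coeff_partIn, coeff_zero]
      split_ifs with hγ
      · by_contra hc
        exact h ((mem_V.1 hq' γ (mem_support_iff.2 hc)).symm.trans hγ)
      · rfl
  have h2 := eq_zero_of_sum_isotypic_eq_zero (l := p.1) ((s.filter (·.1 = p.1)).image Prod.snd)
    (fun τ => v (p.1, τ)) ?_ ?_ p.2 ?_
  · exact h2
  · intro τ hτ
    obtain ⟨⟨q1, q2⟩, hq, rfl⟩ := Finset.mem_image.1 hτ
    obtain ⟨hqs, rfl⟩ := Finset.mem_filter.1 hq
    exact hv _ hqs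
  · rw [Finset.sum_image, ← h1]
    · refine Finset.sum_congr rfl fun q hq => ?_
      rw [← (Finset.mem_filter.1 hq).2]
    · intro q hq q' hq' h
      exact Prod.ext ((Finset.mem_filter.1 hq).2.trans (Finset.mem_filter.1 hq').2.symm) h
  · exact Finset.mem_image.2 ⟨p, Finset.mem_filter.2 ⟨hp, rfl⟩, rfl⟩

theorem iSup_isotypic : ⨆ p : PartLE N × IrrepClass N, isotypic p.1 p.2 = ⊤ := by
  rw [eq_top_iff]
  intro f _
  rw [f.as_sum]
  refine sum_mem fun γ _ => ?_
  have h1 : monomial γ (coeff γ f) ∈ V (sortDesc γ) := mem_V.2 fun δ hδ => by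
    rw [Finset.mem_singleton.1 (support_monomial_subset hδ)]
  have h2 : ⨆ τ, isotypic (sortDesc γ) τ ≤
      ⨆ p : PartLE N × IrrepClass N, isotypic p.1 p.2 :=
    iSup_le fun τ => le_iSup (fun p : PartLE N × IrrepClass N => isotypic p.1 p.2) (sortDesc γ, τ)
  exact h2 (V_le_iSup_isotypic _ h1)

/-- A label is a pair `(λ, τ)` together with an index. -/
def labelEquiv (N : ℕ) : Label N ≃
    Σ p : PartLE N × IrrepClass N, Fin (Module.finrank ℂ (isotypic p.1 p.2)) where
  toFun t := ⟨(t.part, t.irr), t.idx⟩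
  invFun x := ⟨x.1.1, x.1.2, x.2⟩
  left_inv _ := rfl
  right_inv _ := rfl

theorem exists_basis_of_isInternal {R M ι : Type*} [Ring R] [AddCommGroup M] [Module R M]
    [DecidableEq ι] {A : ι → Submodule R M} (hA : DirectSum.IsInternal A) {α : ι → Type*}
    (b : ∀ i, α i → M) (hb : ∀ i a, b i a ∈ A i) (hli : ∀ i, LinearIndependent R (b i))
    (hsp : ∀ i, A i ≤ Submodule.span R (Set.range (b i))) :
    ∃ B : Module.Basis (Σ i, α i) R M, ∀ x, B x = b x.1 x.2 := by
  let v : ∀ i, Module.Basis (α i) R (A i) := fun i =>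
    Module.Basis.mk (v := fun a => (⟨b i a, hb i a⟩ : A i))
      (LinearIndependent.of_comp (A i).subtype (hli i)) (by
        rintro ⟨x, hx⟩ _
        have h := hsp i hx
        rw [show b i = (A i).subtype ∘ fun a => (⟨b i a, hb i a⟩ : A i) from rfl, Set.range_comp,
          ← Submodule.map_span] at h
        obtain ⟨y, hy, rfl⟩ := h
        exact hy)
  refine ⟨hA.collectedBasis v, fun x => ?_⟩
  rw [hA.collectedBasis_coe]
  simp [v]

theorem exists_basis_of_isotypic (b : Label N → Poly N)
    (hb : ∀ t, b t ∈ isotypic t.part t.irr)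
    (hli : ∀ l τ, LinearIndependent ℂ fun i => b ⟨l, τ, i⟩)
    (hsp : ∀ l τ, isotypic l τ ≤ Submodule.span ℂ (Set.range fun i => b ⟨l, τ, i⟩)) :
    ∃ B : Module.Basis (Label N) ℂ (Poly N), ⇑B = b := by
  classical
  obtain ⟨B, hB⟩ := exists_basis_of_isInternal
    ((DirectSum.isInternal_submodule_iff_iSupIndep_and_iSup_eq_top _).2
      ⟨iSupIndep_isotypic (N := N), iSup_isotypic⟩)
    (fun p i => b ⟨p.1, p.2, i⟩) (fun p i => hb ⟨p.1, p.2, i⟩) (fun p => hli p.1 p.2)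
    (fun p => hsp p.1 p.2)
  refine ⟨B.reindex (labelEquiv N).symm, funext fun t => ?_⟩
  rw [Module.Basis.reindex_apply, hB]
  rfl

/-! ### Unitriangular change of basis -/

section Triangular

variable {R M ι : Type*} [Ring R] [AddCommGroup M] [Module R M]

theorem mem_span_of_triangular {b F : ι → M} (r : ι → ℕ)
    (h : ∀ t, b t - F t ∈ Submodule.span R (b '' {s | r s < r t})) (t : ι) :
    b t ∈ Submodule.span R (Set.range F) := by
  induction hn : r t using Nat.strong_induction_on generalizing t with
  | _ n ih =>
    have h1 : Submodule.span R (b '' {s | r s < r t}) ≤ Submodule.span R (Set.range F) := by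
      rw [Submodule.span_le]
      rintro _ ⟨s, hs, rfl⟩
      exact ih (r s) (hn ▸ hs) s rfl
    have := add_mem (h1 (h t)) (Submodule.subset_span (Set.mem_range_self t))
    rwa [sub_add_cancel] at this

theorem linearIndependent_of_triangular (b : Module.Basis ι R M) {F : ι → M} (r : ι → ℕ)
    (h : ∀ t, b t - F t ∈ Submodule.span R (b '' {s | r s < r t})) : LinearIndependent R F := by
  classical
  -- `F s` has coordinate `1` at `s`; its other nonzero coordinates have rank strictly below `r s`.
  have hrepr : ∀ s t, r s ≤ r t → b.repr (F s) t = if s = t then 1 else 0 := by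
    intro s t hst
    have h0 : b.repr (b s - F s) t = 0 := by
      have := b.repr_support_subset_of_mem_span _ (h s)
      by_contra hne
      exact absurd (this (Finsupp.mem_support_iff.2 hne)) (not_lt.2 hst)
    rw [map_sub, Finsupp.sub_apply, b.repr_self, sub_eq_zero, Finsupp.single_apply] at h0
    exact h0.symm
  rw [linearIndependent_iff']
  intro s c hc
  by_contra! hne
  obtain ⟨i, hi, hci⟩ := hne
  -- At an index of maximal rank among the nonzero coefficients, no other term of the relation
  -- contributes to the coordinate.
  obtain ⟨t, ht, hmax⟩ := (s.filter (c · ≠ 0)).exists_max_image r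
    ⟨i, Finset.mem_filter.2 ⟨hi, hci⟩⟩
  obtain ⟨hts, hct⟩ := Finset.mem_filter.1 ht
  have h1 := congrArg (fun x => b.repr x t) hc
  simp only [map_sum, map_smul, Finsupp.finsetSum_apply, Finsupp.smul_apply, map_zero,
    Finsupp.zero_apply] at h1
  rw [Finset.sum_eq_single_of_mem t hts, hrepr t t le_rfl, if_pos rfl, smul_eq_mul, mul_one] at h1
  · exact hct h1
  · intro j hj hjt
    by_cases hcj : c j = 0
    · rw [hcj, zero_smul]
    · rw [hrepr j t (hmax j (Finset.mem_filter.2 ⟨hj, hcj⟩)), if_neg hjt, smul_zero]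

end Triangular

/-- Each monomial lies in some `V_μ` with `μ ≺ λ`, which is spanned by basis vectors whose partition
has smaller rank. -/
theorem strictLowerSpan_le_span (b : Label N → Poly N) (l : PartLE N)
    (hsp : ∀ l τ, isotypic l τ ≤ Submodule.span ℂ (Set.range fun i => b ⟨l, τ, i⟩)) :
    strictLowerSpan l ≤ Submodule.span ℂ (b '' {s | s.part.rank < l.rank}) := by
  intro f hf
  rw [f.as_sum]
  refine sum_mem fun γ hγ => ?_
  obtain ⟨hle, hne⟩ := mem_strictLowerSpan.1 hf γ hγ
  have h1 : monomial γ (coeff γ f) ∈ V (sortDesc γ) := mem_V.2 fun δ hδ => by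
    rw [Finset.mem_singleton.1 (support_monomial_subset hδ)]
  refine (V_le_iSup_isotypic _).trans (iSup_le fun τ => (hsp _ τ).trans ?_) h1
  refine Submodule.span_mono ?_
  rintro _ ⟨i, rfl⟩
  exact ⟨_, hle.rank_lt hne, rfl⟩

/-- Comparing coordinates in `T m G = c m • G` forces equal eigenvalues wherever the coordinate is
nonzero. The set `S` covers joint eigenvectors and those of a single operator alike. -/
theorem mem_span_of_eigenvector {ι κ M : Type*} [AddCommGroup M] [Module ℂ M]
    (B : Module.Basis ι ℂ M) {T : κ → Module.End ℂ M} {χ : ι → κ → ℂ}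
    (hB : ∀ t m, T m (B t) = χ t m • B t) {S : Set κ} {c : κ → ℂ} {G : M}
    (hG : ∀ m ∈ S, T m G = c m • G) :
    G ∈ Submodule.span ℂ (B '' {t | ∀ m ∈ S, χ t m = c m}) := by
  rw [B.mem_span_image]
  intro t ht m hm
  have hrepr : ∀ x : M, B.repr (T m x) t = χ t m * B.repr x t := by
    intro x
    have : (B.coord t) ∘ₗ T m = χ t m • B.coord t := by
      refine B.ext fun s => ?_
      simp only [LinearMap.comp_apply, hB, map_smul, LinearMap.smul_apply, B.coord_apply,
        B.repr_self, smul_eq_mul]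
      rcases eq_or_ne s t with rfl | hst
      · rfl
      · rw [Finsupp.smul_apply, Finsupp.single_eq_of_ne hst.symm, smul_zero, mul_zero]
    exact LinearMap.congr_fun this x
  have h1 := hrepr G
  rw [hG m hm, map_smul, Finsupp.smul_apply, smul_eq_mul] at h1
  exact (mul_right_cancel₀ (Finsupp.mem_support_iff.1 ht) h1).symm

end HeckmanPolychronakos

end

/-! ### Assembly of the theorem -/

open HeckmanPolychronakos in
theorem theorem4p2 (N : ℕ) (hN : 1 ≤ N) (θ : ℝ) (hθ : 0 < θ) :
    ∃ (F : HeckmanPolychronakos.Label N → MvPolynomial (Fin N) ℂ)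
      (eig : HeckmanPolychronakos.Label N → ℕ → ℂ),
      -- each `F_{λ,τ,i}` is a joint eigenfunction of all `P_m`, `m ≥ 1`, with eigenvalues `eig`
      (∀ t, ∀ m ≥ 1, (HeckmanPolychronakos.hpOp N θ m).HasEigenvector (eig t m) (F t)) ∧
      (∀ t, (F t).IsHomogeneous t.part.size) ∧
      (∀ t, ∀ γ ∈ (F t).support,
        HeckmanPolychronakos.DomLE (HeckmanPolychronakos.sortDesc γ) t.part) ∧
      (∀ t, HeckmanPolychronakos.partIn t.part (F t) ∈
        HeckmanPolychronakos.isotypic t.part t.irr) ∧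
      -- the functions form a basis of the space of all polynomials
      LinearIndependent ℂ F ∧
      Submodule.span ℂ (Set.range F) = ⊤ ∧
      -- every joint eigenfunction, and every eigenfunction of a single `P_m`, is a linear
      -- combination of those `F_{λ,τ,i}` that have the same eigenvalue(s)
      (∀ (c : ℕ → ℂ) (G : MvPolynomial (Fin N) ℂ),
        (∀ m ≥ 1, (HeckmanPolychronakos.hpOp N θ m).HasEigenvector (c m) G) →
          G ∈ Submodule.span ℂ (F '' {t | ∀ m ≥ 1, eig t m = c m})) ∧
      (∀ m ≥ 1, ∀ (c : ℂ) (G : MvPolynomial (Fin N) ℂ),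
        (HeckmanPolychronakos.hpOp N θ m).HasEigenvector c G →
          G ∈ Submodule.span ℂ (F '' {t | eig t m = c})) := by
  choose F₀ χ₀ heig hlow hiso hli hsp using fun l τ => exists_eigenfunctions (N := N) hθ l τ
  let F : Label N → Poly N := fun t => F₀ t.part t.irr t.idx
  let b : Label N → Poly N := fun t => partIn t.part (F t)
  let χ : Label N → ℕ → ℂ := fun t => χ₀ t.part t.irr t.idx
  have hχ : ∀ t m, hpOp N θ m (F t) = χ t m • F t := fun t => heig t.part t.irr t.idx
  have hF : ∀ t, F t ∈ lowerSpan t.part := fun t => hlow t.part t.irr t.idx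
  obtain ⟨B, hB⟩ := exists_basis_of_isotypic b (fun t => hiso t.part t.irr t.idx) hli hsp
  -- `B t` is the leading part of `F t`, so the difference is strictly lower.
  have htri : ∀ t, B t - F t ∈ Submodule.span ℂ (B '' {s | s.part.rank < t.part.rank}) := by
    intro t
    rw [hB, ← neg_sub]
    exact neg_mem (strictLowerSpan_le_span b t.part hsp (sub_partIn_mem_strictLowerSpan (hF t)))
  have hFli : LinearIndependent ℂ F := linearIndependent_of_triangular B _ htri
  have hFsp : Submodule.span ℂ (Set.range F) = ⊤ := by
    rw [eq_top_iff, ← B.span_eq, Submodule.span_le]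
    rintro _ ⟨t, rfl⟩
    exact mem_span_of_triangular _ htri t
  let BF := Module.Basis.mk hFli hFsp.ge
  have hBF : ⇑BF = F := Module.Basis.coe_mk _ _
  have hBχ : ∀ t m, hpOp N θ m (BF t) = χ t m • BF t := by simpa only [hBF] using hχ
  refine ⟨F, χ, fun t m _ => ⟨Module.End.mem_eigenspace_iff.2 (hχ t m), hFli.ne_zero t⟩,
    fun t => isHomogeneous_of_mem_lowerSpan (hF t), fun t => mem_lowerSpan.1 (hF t),
    fun t => hiso t.part t.irr t.idx, hFli, hFsp, fun c G hG => ?_, fun m _ c G hG => ?_⟩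
  · have := mem_span_of_eigenvector BF hBχ (S := {m | m ≥ 1}) (c := c) (G := G)
      fun m hm => (hG m hm).apply_eq_smul
    rwa [hBF] at this
  · have := mem_span_of_eigenvector BF hBχ (S := {m}) (c := fun _ => c) (G := G)
      (by rintro _ rfl; exact hG.apply_eq_smul)
    rw [hBF] at this
    simpa using this
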